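/- Let $n\ge 1$, and let $\mathbb H_n$ be the Siegel upper half space of complex symmetric $n\times n$ matrices $Z=X+iY$ with $Y$ positive definite. For $g=\begin{pmatrix}A&B\\C&D\end{pmatrix}\in \mathrm{Sp}_{2n}(\mathbb R)$ and $Z\in\mathbb H_n$ put $gZ=(AZ+B)(CZ+D)^{-1}$ and $J(g,Z)=CZ+D$. Let $(\rho,V)$ be an irreducible finite-dimensional rational complex representation of $\mathrm{GL}_n(\mathbb C)$ with highest weight $\lambda_1\ge\dots\ge\lambda_n\ge 0$ (integers), and for $F:\mathbb H_n\to V$ put $(F|_\rho g)(Z)=\rho(J(g,Z))^{-1}F(gZ)$. For an integer $p\ge 0$ let $T_n^p$ be the set of families $b=(b_{ij})_{1\le i\le j\le n}$ of non-negative integers with $\sum b_{ij}\le p$, and for a symmetric real matrix $U=(u_{ij})$ let $[U]^b=\prod_{i\le j}u_{ij}^{b_{ij}}$. Let $N^p(\mathbb H_n)$ be the space of functions $f(Z)=\sum_{b\in T_n^p}G_b(Z)[Y^{-1}]^b$ with all $G_b$ holomorphic on $\mathbb H_n$. Such an $f$ has a nice Fourier expansion if for some integer $N\ge1$ there are complex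 numbers $a_b(S)$ with $$f(Z)=\sum_{b\in T_n^p}\ \sum_{0\le S\in\frac1N M_n^{\mathrm{sym}}(\mathbb Z)}a_b(S)\,e^{2\pi i\,\mathrm{Tr}(SZ)}[Y^{-1}]^b,$$ the sum converging absolutely, and uniformly on compact subsets of $\mathbb H_n$. A congruence subgroup is a subgroup of $\mathrm{Sp}_{2n}(\mathbb Q)$ that is commensurable with $\mathrm{Sp}_{2n}(\mathbb Z)$ and contains a principal congruence subgroup of $\mathrm{Sp}_{2n}(\mathbb Z)$. Let $N_\rho^{(n)}$ be the set of nearly holomorphic Siegel modular forms of weight $\rho$: the functions $F:\mathbb H_n\to V$ for which there are a congruence subgroup $\Gamma$ and an integer $p\ge0$ such that $F|_\rho\gamma=F$ for all $\gamma\in\Gamma$ and, for every $g\in\mathrm{Sp}_{2n}(\mathbb Q)$ and every linear map $\ell:V\to\mathbb C$, the function $\ell\circ(F|_\rho g)$ lies in $N^p(\mathbb H_n)$ and has a nice Fourier expansion (with this $p$). **Theorem.** Let $F\in N_\rho^{(n)}$, let $\vec\Phi_F(g)=\rho(J(g,i1_n))^{-1}F(g\cdot i1_n)$ for $g\in\mathrm{Sp}_{2n}(\mathbb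 R)$, let $L:V\to\mathbb C$ be a linear functional, and let $\Phi_F=L\circ\vec\Phi_F$. Then $\Phi_F$ has moderate growth: there are a constant $C$ and a positive integer $r$ such that $$|\Phi_F(g)|\le C\,\mathrm{Tr}(g^*g)^r\qquad\text{for all }g\in\mathrm{Sp}_{2n}(\mathbb R).$$ More precisely, there is a constant $C$ (depending on $F$ and $L$) such that this inequality holds for every real $r\ge n\lambda_1/2$ and all $g\in\mathrm{Sp}_{2n}(\mathbb R)$. -/

import Mathlib

open Matrix

/-! ### The Siegel upper half space -/

/-- The Siegel upper half space `ℍ_n`: the complex symmetric `n × n` matrices `Z = X + iY` whose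
imaginary part `Y` is positive definite. -/
def SiegelUpperHalfSpace (n : ℕ) : Set (Matrix (Fin n) (Fin n) ℂ) :=
  {Z | Z.IsSymm ∧ (Z.map Complex.im).PosDef}

namespace SiegelUpperHalfSpace

variable {n : ℕ}

/-- The imaginary part `Y` of `Z = X + iY`. -/
def imPart (Z : SiegelUpperHalfSpace n) : Matrix (Fin n) (Fin n) ℝ :=
  (Z : Matrix (Fin n) (Fin n) ℂ).map Complex.im

/-- The base point `i · 1_n` of `ℍ_n`. -/
noncomputable def basePoint (n : ℕ) : SiegelUpperHalfSpace n :=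
  ⟨Complex.I • (1 : Matrix (Fin n) (Fin n) ℂ), by
    refine ⟨by simp [Matrix.IsSymm], ?_⟩
    have h : (Complex.I • (1 : Matrix (Fin n) (Fin n) ℂ)).map Complex.im = 1 := by
      ext i j
      by_cases hij : i = j <;> simp [Matrix.one_apply, hij]
    rw [h]
    exact Matrix.PosDef.one⟩

/-- The set `R_n = {(i, j) : i ≤ j}` of positions on or above the diagonal. -/
abbrev UpperIndex (n : ℕ) : Type := {ij : Fin n × Fin n // ij.1 ≤ ij.2}

/-- The coordinates `(Z_{ij})_{i ≤ j}`, which identify `ℍ_n` with an open subset of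
`ℂ^{n(n+1)/2}`. -/
def coords (Z : SiegelUpperHalfSpace n) : UpperIndex n → ℂ :=
  fun ij => (Z : Matrix (Fin n) (Fin n) ℂ) ij.1.1 ij.1.2

/-- `G : ℍ_n → ℂ` is holomorphic: it is a complex differentiable function of the coordinates
`(Z_{ij})_{i ≤ j}` on the open set `coords(ℍ_n)`. -/
def IsHolomorphic (G : SiegelUpperHalfSpace n → ℂ) : Prop :=
  ∃ g : (UpperIndex n → ℂ) → ℂ,
    DifferentiableOn ℂ g (Set.range (coords (n := n))) ∧ ∀ Z, G Z = g (coords Z)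

end SiegelUpperHalfSpace

/-! ### The symplectic group and its action -/

namespace SiegelForms

open SiegelUpperHalfSpace

variable {n : ℕ}

/-- `Sp_{2n}(R)`, in `n × n` blocks, for the standard alternating form. -/
abbrev Sp (n : ℕ) (R : Type) [CommRing R] : Type := Matrix.symplecticGroup (Fin n) R

/-- The entrywise map `Sp_{2n}(R) → Sp_{2n}(S)` induced by a ring homomorphism `R → S`. -/
def spMap {R S : Type} [CommRing R] [CommRing S] (f : R →+* S) : Sp n R →* Sp n S where
  toFun g := ⟨(g : Matrix (Fin n ⊕ Fin n) (Fin n ⊕ Fin n) R).map f, SymplecticGroup.map_mem g.2 f⟩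
  map_one' := by
    apply Subtype.ext
    simp
  map_mul' g h := by
    apply Subtype.ext
    simp [Matrix.map_mul]

/-- The block `A` of `g = [A B; C D]`, as a complex matrix. -/
def blockA (g : Sp n ℝ) : Matrix (Fin n) (Fin n) ℂ :=
  (g : Matrix (Fin n ⊕ Fin n) (Fin n ⊕ Fin n) ℝ).toBlocks₁₁.map Complex.ofReal
/-- The block `B` of `g = [A B; C D]`, as a complex matrix. -/
def blockB (g : Sp n ℝ) : Matrix (Fin n) (Fin n) ℂ :=
  (g : Matrix (Fin n ⊕ Fin n) (Fin n ⊕ Fin n) ℝ).toBlocks₁₂.map Complex.ofReal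
/-- The block `C` of `g = [A B; C D]`, as a complex matrix. -/
def blockC (g : Sp n ℝ) : Matrix (Fin n) (Fin n) ℂ :=
  (g : Matrix (Fin n ⊕ Fin n) (Fin n ⊕ Fin n) ℝ).toBlocks₂₁.map Complex.ofReal
/-- The block `D` of `g = [A B; C D]`, as a complex matrix. -/
def blockD (g : Sp n ℝ) : Matrix (Fin n) (Fin n) ℂ :=
  (g : Matrix (Fin n ⊕ Fin n) (Fin n ⊕ Fin n) ℝ).toBlocks₂₂.map Complex.ofReal

/-- The numerator `AZ + B` of the action. -/
def numMatrix (g : Sp n ℝ) (Z : SiegelUpperHalfSpace n) : Matrix (Fin n) (Fin n) ℂ :=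
  blockA g * Z + blockB g

/-- The matrix `J(g, Z) = CZ + D`. -/
def denomMatrix (g : Sp n ℝ) (Z : SiegelUpperHalfSpace n) : Matrix (Fin n) (Fin n) ℂ :=
  blockC g * Z + blockD g

theorem block_relations (g : Sp n ℝ) :
    (blockA g)ᵀ * blockC g = (blockC g)ᵀ * blockA g ∧
    (blockB g)ᵀ * blockD g = (blockD g)ᵀ * blockB g ∧
    (blockA g)ᵀ * blockD g - (blockC g)ᵀ * blockB g = 1 := by
  have h := g.2
  rw [← Matrix.fromBlocks_toBlocks (g : Matrix (Fin n ⊕ Fin n) (Fin n ⊕ Fin n) ℝ),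
    SymplecticGroup.fromBlocks_mem_iff] at h
  obtain ⟨h1, h2, h3⟩ := h
  have e (M N : Matrix (Fin n) (Fin n) ℝ) : (M.map Complex.ofReal)ᵀ * N.map Complex.ofReal
      = (Mᵀ * N).map Complex.ofReal := by
    rw [← Matrix.transpose_map]
    exact (Matrix.map_mul (f := Complex.ofRealHom)).symm
  refine ⟨?_, ?_, ?_⟩
  · simp only [blockA, blockC, e, h1]
  · simp only [blockB, blockD, e, h2]
  · simp only [blockA, blockB, blockC, blockD, e]
    rw [← Matrix.map_sub Complex.ofReal (by intros; simp), h3]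
    simp

theorem block_star (M : Matrix (Fin n) (Fin n) ℝ) :
    (M.map Complex.ofReal)ᴴ = (M.map Complex.ofReal)ᵀ := by
  ext i j
  simp

theorem num_transpose_mul_denom (g : Sp n ℝ) (Z : SiegelUpperHalfSpace n) :
    (numMatrix g Z)ᵀ * denomMatrix g Z = (denomMatrix g Z)ᵀ * numMatrix g Z := by
  obtain ⟨h1, h2, h3⟩ := block_relations g
  have h4 : (blockD g)ᵀ * blockA g - (blockB g)ᵀ * blockC g = 1 := by
    simpa using congrArg Matrix.transpose h3
  have hZ : (Z : Matrix (Fin n) (Fin n) ℂ)ᵀ = Z := Z.2.1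
  simp only [numMatrix, denomMatrix, Matrix.transpose_add, Matrix.transpose_mul, hZ]
  generalize (Z : Matrix (Fin n) (Fin n) ℂ) = W
  rw [← sub_eq_zero]
  have : (W * (blockA g)ᵀ + (blockB g)ᵀ) * (blockC g * W + blockD g) -
      (W * (blockC g)ᵀ + (blockD g)ᵀ) * (blockA g * W + blockB g) =
      W * ((blockA g)ᵀ * blockC g - (blockC g)ᵀ * blockA g) * W
      + W * ((blockA g)ᵀ * blockD g - (blockC g)ᵀ * blockB g)
      - ((blockD g)ᵀ * blockA g - (blockB g)ᵀ * blockC g) * W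
      + ((blockB g)ᵀ * blockD g - (blockD g)ᵀ * blockB g) := by noncomm_ring
  rw [this, h1, h2, h3, h4]
  simp

theorem denom_star_mul_num (g : Sp n ℝ) (Z : SiegelUpperHalfSpace n) :
    (denomMatrix g Z)ᴴ * numMatrix g Z - (numMatrix g Z)ᴴ * denomMatrix g Z =
      (2 * Complex.I) • (imPart Z).map Complex.ofReal := by
  obtain ⟨h1, h2, h3⟩ := block_relations g
  have h4 : (blockD g)ᵀ * blockA g - (blockB g)ᵀ * blockC g = 1 := by
    simpa using congrArg Matrix.transpose h3
  have hY : (Z : Matrix (Fin n) (Fin n) ℂ) - (Z : Matrix (Fin n) (Fin n) ℂ)ᴴ =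
      (2 * Complex.I) • (imPart Z).map Complex.ofReal := by
    ext i j
    have hZ : (Z : Matrix (Fin n) (Fin n) ℂ) j i = (Z : Matrix (Fin n) (Fin n) ℂ) i j :=
      Z.2.1.apply i j
    simp only [imPart, Matrix.sub_apply, Matrix.conjTranspose_apply, Matrix.smul_apply,
      Matrix.map_apply, hZ, smul_eq_mul]
    apply Complex.ext <;> simp
    ring
  rw [← hY]
  have sA : (blockA g)ᴴ = (blockA g)ᵀ := block_star _
  have sB : (blockB g)ᴴ = (blockB g)ᵀ := block_star _
  have sC : (blockC g)ᴴ = (blockC g)ᵀ := block_star _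
  have sD : (blockD g)ᴴ = (blockD g)ᵀ := block_star _
  simp only [numMatrix, denomMatrix, Matrix.conjTranspose_add, Matrix.conjTranspose_mul,
    sA, sB, sC, sD]
  generalize (Z : Matrix (Fin n) (Fin n) ℂ) = W
  have : (Wᴴ * (blockC g)ᵀ + (blockD g)ᵀ) * (blockA g * W + blockB g) -
      (Wᴴ * (blockA g)ᵀ + (blockB g)ᵀ) * (blockC g * W + blockD g) =
      ((blockD g)ᵀ * blockA g - (blockB g)ᵀ * blockC g) * W
      - Wᴴ * ((blockA g)ᵀ * blockD g - (blockC g)ᵀ * blockB g)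
      - Wᴴ * ((blockA g)ᵀ * blockC g - (blockC g)ᵀ * blockA g) * W
      - ((blockB g)ᵀ * blockD g - (blockD g)ᵀ * blockB g) := by noncomm_ring
  rw [this, h1, h2, h3, h4]
  simp

theorem quadForm_re_pos {Y : Matrix (Fin n) (Fin n) ℝ} (hY : Y.PosDef) {u : Fin n → ℂ}
    (hu : u ≠ 0) : 0 < (star u ⬝ᵥ (Y.map Complex.ofReal *ᵥ u)).re := by
  set a : Fin n → ℝ := fun i => (u i).re with ha
  set b : Fin n → ℝ := fun i => (u i).im with hb
  have key : (star u ⬝ᵥ (Y.map Complex.ofReal *ᵥ u)).re = a ⬝ᵥ (Y *ᵥ a) + b ⬝ᵥ (Y *ᵥ b) := by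
    simp only [dotProduct, mulVec, ha, hb, Complex.re_sum, Finset.mul_sum, ← Finset.sum_add_distrib]
    refine Finset.sum_congr rfl fun i _ => Finset.sum_congr rfl fun j _ => ?_
    simp
  have nonneg (x : Fin n → ℝ) : 0 ≤ x ⬝ᵥ (Y *ᵥ x) := by
    simpa using hY.posSemidef.dotProduct_mulVec_nonneg x
  have pos {x : Fin n → ℝ} (hx : x ≠ 0) : 0 < x ⬝ᵥ (Y *ᵥ x) := by
    simpa using hY.dotProduct_mulVec_pos hx
  rw [key]
  by_cases h0 : a = 0
  · have : b ≠ 0 := by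
      intro h1
      apply hu
      ext i
      exact Complex.ext (congrFun h0 i) (congrFun h1 i)
    exact add_pos_of_nonneg_of_pos (nonneg a) (pos this)
  · exact add_pos_of_pos_of_nonneg (pos h0) (nonneg b)

theorem im_quadForm (g : Sp n ℝ) (Z : SiegelUpperHalfSpace n) (u : Fin n → ℂ) :
    (star (denomMatrix g Z *ᵥ u) ⬝ᵥ (numMatrix g Z *ᵥ u)).im =
      (star u ⬝ᵥ ((imPart Z).map Complex.ofReal *ᵥ u)).re := by
  have h := congrArg (fun M => star u ⬝ᵥ (M *ᵥ u)) (denom_star_mul_num g Z)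
  simp only [Matrix.sub_mulVec, dotProduct_sub, Matrix.smul_mulVec, dotProduct_smul,
    ← Matrix.mulVec_mulVec, Matrix.dotProduct_mulVec (star u) (_ᴴ), ← Matrix.star_mulVec] at h
  have hs : star (numMatrix g Z *ᵥ u) ⬝ᵥ (denomMatrix g Z *ᵥ u) =
      star (star (denomMatrix g Z *ᵥ u) ⬝ᵥ (numMatrix g Z *ᵥ u)) := by
    simp [dotProduct, star_sum, mul_comm]
  rw [hs] at h
  have := congrArg Complex.im h
  simp at this
  linarith

/-- `CZ + D` is invertible. -/
theorem isUnit_det_denom (g : Sp n ℝ) (Z : SiegelUpperHalfSpace n) :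
    IsUnit (denomMatrix g Z).det := by
  rw [isUnit_iff_ne_zero]
  intro h0
  obtain ⟨u, hu, hu0⟩ := Matrix.exists_mulVec_eq_zero_iff.mpr h0
  have h1 := im_quadForm g Z u
  have h2 := quadForm_re_pos Z.2.2 hu
  rw [hu0] at h1
  simp only [star_zero, zero_dotProduct, Complex.zero_im] at h1
  exact absurd h1 h2.ne

theorem action_mem (g : Sp n ℝ) (Z : SiegelUpperHalfSpace n) :
    numMatrix g Z * (denomMatrix g Z)⁻¹ ∈ SiegelUpperHalfSpace n := by
  have hu := isUnit_det_denom g Z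
  have hsymm : (numMatrix g Z * (denomMatrix g Z)⁻¹).IsSymm := by
    have h := num_transpose_mul_denom g Z
    have hut : IsUnit (denomMatrix g Z)ᵀ.det := by rwa [Matrix.det_transpose]
    rw [Matrix.IsSymm, Matrix.transpose_mul, Matrix.transpose_nonsing_inv]
    calc ((denomMatrix g Z)ᵀ)⁻¹ * (numMatrix g Z)ᵀ
        = ((denomMatrix g Z)ᵀ)⁻¹ * ((numMatrix g Z)ᵀ * denomMatrix g Z) * (denomMatrix g Z)⁻¹ := by
          rw [← Matrix.mul_assoc, Matrix.mul_nonsing_inv_cancel_right _ _ hu]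
      _ = numMatrix g Z * (denomMatrix g Z)⁻¹ := by
          rw [h, Matrix.nonsing_inv_mul_cancel_left _ _ hut]
  refine ⟨hsymm, Matrix.PosDef.of_dotProduct_mulVec_pos ?_ ?_⟩
  · ext i j
    simp only [Matrix.conjTranspose_apply, Matrix.map_apply, star_trivial]
    rw [hsymm.apply i j]
  · intro x hx
    set w : Fin n → ℂ := fun i => (x i : ℂ) with hw
    set u : Fin n → ℂ := (denomMatrix g Z)⁻¹ *ᵥ w with hudef
    have hQu : denomMatrix g Z *ᵥ u = w := by
      rw [hudef, Matrix.mulVec_mulVec, Matrix.mul_nonsing_inv _ hu, Matrix.one_mulVec]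
    have hu0 : u ≠ 0 := by
      intro h0
      rw [h0, Matrix.mulVec_zero] at hQu
      apply hx
      ext i
      have := congrFun hQu i
      simpa [hw] using this.symm
    have h1 := im_quadForm g Z u
    have h2 := quadForm_re_pos Z.2.2 hu0
    rw [hQu, hudef, Matrix.mulVec_mulVec, ← hudef] at h1
    have h3 : (star w ⬝ᵥ ((numMatrix g Z * (denomMatrix g Z)⁻¹) *ᵥ w)).im =
        star x ⬝ᵥ ((numMatrix g Z * (denomMatrix g Z)⁻¹).map Complex.im *ᵥ x) := by
      simp only [dotProduct, mulVec, hw, Complex.im_sum, Finset.mul_sum]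
      refine Finset.sum_congr rfl fun i _ => Finset.sum_congr rfl fun j _ => ?_
      simp
    rw [← h3, h1]
    exact h2

/-- The action `gZ = (AZ + B)(CZ + D)⁻¹` of `Sp_{2n}(ℝ)` on `ℍ_n`. -/
noncomputable def act (g : Sp n ℝ) (Z : SiegelUpperHalfSpace n) : SiegelUpperHalfSpace n :=
  ⟨numMatrix g Z * (denomMatrix g Z)⁻¹, action_mem g Z⟩

/-- The factor of automorphy `J(g, Z) = CZ + D`, as an element of `GL_n(ℂ)`. -/
noncomputable def autFactor (g : Sp n ℝ) (Z : SiegelUpperHalfSpace n) :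
    Matrix.GeneralLinearGroup (Fin n) ℂ :=
  Matrix.GeneralLinearGroup.mk'' (denomMatrix g Z) (isUnit_det_denom g Z)

/-! ### Nearly holomorphic functions and Fourier expansions -/

/-- The set `T_n^p` of exponents `b = (b_{ij})_{i ≤ j}` of non-negative integers whose sum is at
most `p`. -/
def exponents (n p : ℕ) : Finset (UpperIndex n → ℕ) :=
  (Fintype.piFinset fun _ => Finset.range (p + 1)).filter fun b => ∑ ij, b ij ≤ p

theorem mem_exponents {p : ℕ} {b : UpperIndex n → ℕ} :
    b ∈ exponents n p ↔ ∑ ij, b ij ≤ p := by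
  simp only [exponents, Finset.mem_filter, Fintype.mem_piFinset, Finset.mem_range,
    and_iff_right_iff_imp]
  intro h ij
  exact Nat.lt_succ_of_le ((Finset.single_le_sum (fun _ _ => Nat.zero_le _)
    (Finset.mem_univ ij)).trans h)

/-- The monomial `[V]^b = ∏_{i ≤ j} v_{ij}^{b_{ij}}`. -/
def monomial (V : Matrix (Fin n) (Fin n) ℝ) (b : UpperIndex n → ℕ) : ℝ :=
  ∏ ij, V ij.1.1 ij.1.2 ^ b ij

/-- `N^p(ℍ_n)`: the polynomials of total degree at most `p` in the entries of `Y⁻¹`, with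
holomorphic functions on `ℍ_n` as coefficients. -/
def IsNearlyHolomorphic (p : ℕ) (f : SiegelUpperHalfSpace n → ℂ) : Prop :=
  ∃ G : (UpperIndex n → ℕ) → SiegelUpperHalfSpace n → ℂ,
    (∀ b ∈ exponents n p, IsHolomorphic (G b)) ∧
    ∀ Z, f Z = ∑ b ∈ exponents n p, G b Z * (monomial (imPart Z)⁻¹ b : ℂ)

/-- The positive semidefinite matrices in `(1/N) M_n^sym(ℤ)`. -/
def latticePSD (n N : ℕ) : Set (Matrix (Fin n) (Fin n) ℝ) :=
  {S | S.PosSemidef ∧ ∃ T : Matrix (Fin n) (Fin n) ℤ,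
    T.IsSymm ∧ S = (1 / (N : ℝ)) • T.map (Int.cast : ℤ → ℝ)}

/-- The term `a_b(S) e^{2πi Tr(SZ)} [Y⁻¹]^b` of a Fourier expansion. -/
noncomputable def fourierTerm {p N : ℕ} (a : exponents n p → latticePSD n N → ℂ)
    (x : exponents n p × latticePSD n N) (Z : SiegelUpperHalfSpace n) : ℂ :=
  a x.1 x.2 *
    Complex.exp (2 * Real.pi * Complex.I *
      ((x.2 : Matrix (Fin n) (Fin n) ℝ).map Complex.ofReal * (Z : Matrix (Fin n) (Fin n) ℂ)).trace) *
    (monomial (imPart Z)⁻¹ x.1 : ℂ)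

/-- `f ∈ N^p(ℍ_n)` has a nice Fourier expansion: it is the sum of a series of terms
`a_b(S) e^{2πi Tr(SZ)} [Y⁻¹]^b` with `b ∈ T_n^p` and `0 ≤ S ∈ (1/N) M_n^sym(ℤ)`, converging
absolutely, and uniformly on compact subsets of `ℍ_n`. -/
def HasNiceFourierExpansion (p : ℕ) (f : SiegelUpperHalfSpace n → ℂ) : Prop :=
  ∃ N : ℕ, 0 < N ∧ ∃ a : exponents n p → latticePSD n N → ℂ,
    (∀ Z, Summable fun x => ‖fourierTerm a x Z‖) ∧
    ∀ K : Set (SiegelUpperHalfSpace n), IsCompact K → HasSumUniformlyOn (fourierTerm a) f K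

/-! ### Representations of `GL_n(ℂ)` -/

section Representations

variable {V : Type*} [AddCommGroup V] [Module ℂ V]

/-- The representation `ρ` of `GL_n(ℂ)` is rational: every matrix coefficient is a polynomial in
the matrix entries and `det⁻¹`. -/
def IsRational (ρ : Representation ℂ (Matrix.GeneralLinearGroup (Fin n) ℂ) V) : Prop :=
  ∀ (l : V →ₗ[ℂ] ℂ) (v : V), ∃ (P : MvPolynomial (Fin n × Fin n) ℂ) (k : ℕ),
    ∀ g : Matrix.GeneralLinearGroup (Fin n) ℂ,
      l (ρ g v) = MvPolynomial.eval (fun ij => (g : Matrix (Fin n) (Fin n) ℂ) ij.1 ij.2) P *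
        ((g : Matrix (Fin n) (Fin n) ℂ).det ^ k)⁻¹

/-- `lam` is the highest weight of `ρ` (for irreducible `ρ`): some non-zero vector `v` satisfies
`ρ(b) v = (∏ i, b_{ii} ^ lam_i) v` for all invertible upper triangular matrices `b`. -/
def IsHighestWeight (ρ : Representation ℂ (Matrix.GeneralLinearGroup (Fin n) ℂ) V)
    (lam : Fin n → ℤ) : Prop :=
  ∃ v : V, v ≠ 0 ∧ ∀ b : Matrix.GeneralLinearGroup (Fin n) ℂ,
    (∀ i j, j < i → (b : Matrix (Fin n) (Fin n) ℂ) i j = 0) →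
      ρ b v = (∏ i, (b : Matrix (Fin n) (Fin n) ℂ) i i ^ lam i) • v

/-! ### Nearly holomorphic Siegel modular forms -/

/-- `Sp_{2n}(ℤ)` as a subgroup of `Sp_{2n}(ℚ)`. -/
def spInt (n : ℕ) : Subgroup (Sp n ℚ) := (spMap (n := n) (Int.castRingHom ℚ)).range

/-- The principal congruence subgroup of level `N` of `Sp_{2n}(ℤ)`, as a subgroup of
`Sp_{2n}(ℚ)`. -/
def principalCongruence (n N : ℕ) : Subgroup (Sp n ℚ) :=
  (spMap (n := n) (Int.castRingHom (ZMod N))).ker.map (spMap (Int.castRingHom ℚ))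

/-- A congruence subgroup of `Sp_{2n}(ℚ)`: a subgroup commensurable with `Sp_{2n}(ℤ)` that contains
some principal congruence subgroup. -/
def IsCongruenceSubgroup (Γ : Subgroup (Sp n ℚ)) : Prop :=
  Γ.Commensurable (spInt n) ∧ ∃ N : ℕ, 0 < N ∧ principalCongruence n N ≤ Γ

/-- The inclusion `Sp_{2n}(ℚ) → Sp_{2n}(ℝ)`. -/
noncomputable def spRatToReal : Sp n ℚ →* Sp n ℝ := spMap (algebraMap ℚ ℝ)

/-- `(F|_ρ g)(Z) = ρ(J(g, Z))⁻¹ F(gZ)`. -/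
noncomputable def slash (ρ : Representation ℂ (Matrix.GeneralLinearGroup (Fin n) ℂ) V)
    (F : SiegelUpperHalfSpace n → V) (g : Sp n ℝ) : SiegelUpperHalfSpace n → V :=
  fun Z => ρ (autFactor g Z)⁻¹ (F (act g Z))

/-- `F ∈ N_ρ^p(Γ)`. -/
structure IsNearlyHolomorphicFormOn
    (ρ : Representation ℂ (Matrix.GeneralLinearGroup (Fin n) ℂ) V) (p : ℕ)
    (Γ : Subgroup (Sp n ℚ)) (F : SiegelUpperHalfSpace n → V) : Prop where
  nearlyHolomorphic : ∀ (g : Sp n ℚ) (l : V →ₗ[ℂ] ℂ),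
    IsNearlyHolomorphic p (fun Z => l (slash ρ F (spRatToReal g) Z))
  niceFourierExpansion : ∀ (g : Sp n ℚ) (l : V →ₗ[ℂ] ℂ),
    HasNiceFourierExpansion p (fun Z => l (slash ρ F (spRatToReal g) Z))
  transformation : ∀ γ ∈ Γ, slash ρ F (spRatToReal γ) = F

/-- `F ∈ N_ρ^{(n)}`: `F` is a nearly holomorphic Siegel modular form of weight `ρ`, that is,
`F ∈ N_ρ^p(Γ)` for some `p` and some congruence subgroup `Γ`. -/
def IsNearlyHolomorphicForm (ρ : Representation ℂ (Matrix.GeneralLinearGroup (Fin n) ℂ) V)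
    (F : SiegelUpperHalfSpace n → V) : Prop :=
  ∃ (Γ : Subgroup (Sp n ℚ)) (p : ℕ), IsCongruenceSubgroup Γ ∧ IsNearlyHolomorphicFormOn ρ p Γ F

/-- The lift `g ↦ ρ(J(g, i))⁻¹ F(g i)` of `F` to `Sp_{2n}(ℝ)`, where `i` is the base point. -/
noncomputable def vecLift (ρ : Representation ℂ (Matrix.GeneralLinearGroup (Fin n) ℂ) V)
    (F : SiegelUpperHalfSpace n → V) (g : Sp n ℝ) : V :=
  ρ (autFactor g (basePoint n))⁻¹ (F (act g (basePoint n)))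

end Representations

/-! ### Moderate growth -/

/-- `Tr(g* g)`. -/
noncomputable def traceNorm (g : Sp n ℝ) : ℝ :=
  ((g : Matrix (Fin n ⊕ Fin n) (Fin n ⊕ Fin n) ℝ)ᴴ *
    (g : Matrix (Fin n ⊕ Fin n) (Fin n ⊕ Fin n) ℝ)).trace

/-- `Φ : Sp_{2n}(ℝ) → ℂ` has moderate growth (is slowly increasing): there are a constant `C` and a
positive integer `r` with `|Φ(g)| ≤ C Tr(g* g)^r` for all `g`. -/
def HasModerateGrowth (Φ : Sp n ℝ → ℂ) : Prop :=
  ∃ (C : ℝ) (r : ℕ), 0 < r ∧ ∀ g, ‖Φ g‖ ≤ C * traceNorm g ^ r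

end SiegelForms

/-!
The rows of `g ∈ Sp_{2n}(ℝ)` form a symplectic basis of a lattice in `ℂⁿ`. Choosing a nearly
shortest lattice vector and passing to its orthogonal complement yields `γ ∈ Sp_{2n}(ℤ)` such that
`Tr(Y⁻¹)` at the point `γg · i`, which is the sum of the `|J(γg, i)_{ij}|²`, is at most a constant
depending only on `n`. Since `F` has only finitely many translates `G = F|γ⁻¹`, it suffices to bound
`ℓ(ρ(J)⁻¹ G(γg · i))` for a fixed `G` and `J = J(γg, i)`. The values of `G` are bounded in the
region in question, because there `Y ≥ H⁻¹` and `|Y⁻¹| ≤ H` entrywise for a fixed `H`, so that the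
Fourier expansion is dominated by its absolutely convergent value at `iH⁻¹`. The factor
`det(J)^{λ₁} ρ(J)⁻¹` is bounded for bounded `J`: on a highest weight vector this follows by writing
`J` as the product of a triangular and a unitary matrix, and the vectors for which it holds form a
subrepresentation.

It remains to bound `|det J|^{-λ₁}`. Here `|det J|²` is the Gram determinant of the lower rows of
`γg`; as `ggᵀ ≥ Tr(g*g)⁻¹` and the Gram determinant of the lower rows of the integral matrix `γ` is
at least `1`, it is at least `Tr(g*g)^{-n}`.
-/

namespace SiegelForms

/-! ### Symplectic systems in lattices -/

section SystemLattice

variable {E ι κ : Type*} [AddCommGroup E]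

/-- The lattice generated by the vectors `e i` and `f i`. -/
def systemLattice (e f : ι → E) : Submodule ℤ E := Submodule.span ℤ (Set.range (Sum.elim e f))

theorem left_mem_systemLattice (e f : ι → E) (i : ι) : e i ∈ systemLattice e f :=
  Submodule.subset_span ⟨Sum.inl i, rfl⟩

theorem right_mem_systemLattice (e f : ι → E) (i : ι) : f i ∈ systemLattice e f :=
  Submodule.subset_span ⟨Sum.inr i, rfl⟩

theorem systemLattice_le {e f : ι → E} {Λ : Submodule ℤ E} :
    systemLattice e f ≤ Λ ↔ (∀ i, e i ∈ Λ) ∧ ∀ i, f i ∈ Λ := by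
  simp [systemLattice, Submodule.span_le, Set.range_subset_iff]

theorem systemLattice_map {F : Type*} [AddCommGroup F] (φ : E →ₗ[ℤ] F) (e f : ι → E) :
    systemLattice (fun i => φ (e i)) (fun i => φ (f i)) = (systemLattice e f).map φ := by
  rw [systemLattice, systemLattice, Submodule.map_span, ← Set.range_comp, Sum.comp_elim]
  rfl

theorem systemLattice_comp_le (e f : ι → E) (σ : κ → ι) :
    systemLattice (e ∘ σ) (f ∘ σ) ≤ systemLattice e f :=
  systemLattice_le.2 ⟨fun _ => left_mem_systemLattice e f _, fun _ => right_mem_systemLattice e f _⟩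

theorem systemLattice_cons_le {n : ℕ} {e f : Fin (n + 1) → E} {x y : Fin n → E}
    (hxy : systemLattice x y ≤ systemLattice (e ∘ Fin.succ) (f ∘ Fin.succ)) :
    systemLattice (Fin.cons (e 0) x : Fin (n + 1) → E) (Fin.cons (f 0) y) ≤
      systemLattice e f := by
  have hle : systemLattice x y ≤ systemLattice e f :=
    hxy.trans (systemLattice_comp_le e f _)
  rw [systemLattice_le] at hle ⊢
  exact ⟨Fin.cases (left_mem_systemLattice e f 0) hle.1,
    Fin.cases (right_mem_systemLattice e f 0) hle.2⟩

theorem systemLattice_transvection_le [Fintype ι] [DecidableEq ι] (e f : ι → E) (m : ι → ℤ)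
    (k : ι) :
    systemLattice (fun i => e i + m i • e k) (Function.update f k (f k - ∑ l, m l • f l)) ≤
      systemLattice e f := by
  have he := left_mem_systemLattice e f
  have hf := right_mem_systemLattice e f
  refine systemLattice_le.2 ⟨fun i => add_mem (he i) (Submodule.smul_mem _ _ (he k)), fun i => ?_⟩
  rcases eq_or_ne i k with rfl | hik
  · rw [Function.update_self]
    exact sub_mem (hf i) (sum_mem fun l _ => Submodule.smul_mem _ _ (hf l))
  · rw [Function.update_of_ne hik]
    exact hf i

end SystemLattice

/-- The vectors `e i`, `f i` form a symplectic system (a symplectic basis of the lattice that they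
generate) for the biadditive form `ω`. -/
structure IsSymplecticSystem {E R ι : Type*} [AddCommGroup E] [CommRing R] [DecidableEq ι]
    (ω : E →ₗ[ℤ] E →ₗ[ℤ] R) (e f : ι → E) : Prop where
  left : ∀ i j, ω (e i) (e j) = 0
  right : ∀ i j, ω (f i) (f j) = 0
  pair : ∀ i j, ω (e i) (f j) = if i = j then 1 else 0

namespace IsSymplecticSystem

variable {E R ι κ : Type*} [AddCommGroup E] [CommRing R] [DecidableEq ι]
  {ω : E →ₗ[ℤ] E →ₗ[ℤ] R} {e f : ι → E}

theorem pair_swap (h : IsSymplecticSystem ω e f) (hω : ω.IsAlt) (i j : ι) :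
    ω (f i) (e j) = if i = j then -1 else 0 := by
  rw [← hω.neg, h.pair]
  rcases eq_or_ne i j with rfl | hij
  · simp
  · simp [hij, hij.symm]

theorem left_ne_zero [Nontrivial R] (h : IsSymplecticSystem ω e f) (i : ι) : e i ≠ 0 := by
  intro h0
  simpa [h0] using h.pair i i

theorem exists_int_apply (h : IsSymplecticSystem ω e f) (hω : ω.IsAlt) {x y : E}
    (hx : x ∈ systemLattice e f) (hy : y ∈ systemLattice e f) : ∃ m : ℤ, ω x y = m := by
  suffices ω x y ∈ (1 : Submodule ℤ R) by
    obtain ⟨m, hm⟩ := Submodule.mem_one.1 this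
    exact ⟨m, hm.symm⟩
  have h_one : (1 : R) ∈ (1 : Submodule ℤ R) := Submodule.one_le.1 le_rfl
  refine LinearMap.BilinMap.apply_apply_mem_of_mem_span _ _ _ ω ?_ x y hx hy
  rintro _ ⟨i | i, rfl⟩ _ ⟨j | j, rfl⟩
  · simp [h.left]
  · simp only [Sum.elim_inl, Sum.elim_inr, h.pair]
    split_ifs <;> simp [h_one]
  · simp only [Sum.elim_inl, Sum.elim_inr, h.pair_swap hω]
    split_ifs <;> simp [h_one]
  · simp [h.right]

theorem comp_injective [DecidableEq κ] (h : IsSymplecticSystem ω e f) {σ : κ → ι}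
    (hσ : σ.Injective) : IsSymplecticSystem ω (e ∘ σ) (f ∘ σ) where
  left _ _ := h.left _ _
  right _ _ := h.right _ _
  pair i j := by simp [h.pair, hσ.eq_iff]

theorem swap [Unique ι] (h : IsSymplecticSystem ω e f) (hω : ω.IsAlt) (m : ℤ) :
    IsSymplecticSystem ω (fun i => f i + m • e i) (fun i => -e i) where
  left i j := by rw [Subsingleton.elim i j, hω]
  right i j := by rw [Subsingleton.elim i j, hω]
  pair i j := by simp [h.pair_swap hω, h.left, Subsingleton.elim i j]

theorem cons {n : ℕ} {x y : Fin n → E} (h : IsSymplecticSystem ω x y) (hω : ω.IsAlt) {u v : E}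
    (huv : ω u v = 1) (hu : ∀ z ∈ systemLattice x y, ω u z = 0)
    (hv : ∀ z ∈ systemLattice x y, ω v z = 0) :
    IsSymplecticSystem ω (Fin.cons u x : Fin (n + 1) → E) (Fin.cons v y) := by
  have hx := left_mem_systemLattice x y
  have hy := right_mem_systemLattice x y
  refine ⟨?_, ?_, ?_⟩ <;>
    refine Fin.cases (Fin.cases ?_ fun j => ?_) fun i => Fin.cases ?_ fun j => ?_
  · exact hω u
  · exact hu _ (hx j)
  · exact hω.isRefl _ _ (hu _ (hx i))
  · exact h.left i j
  · exact hω v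
  · exact hv _ (hy j)
  · exact hω.isRefl _ _ (hv _ (hy i))
  · exact h.right i j
  · simpa using huv
  · simpa [(Fin.succ_ne_zero j).symm] using hu _ (hy j)
  · simpa [Fin.succ_ne_zero i] using hω.isRefl _ _ (hv _ (hx i))
  · simpa using h.pair i j

theorem transvection [Fintype ι] (h : IsSymplecticSystem ω e f) (m : ι → ℤ)
    {k : ι} (hk : m k = 0) :
    IsSymplecticSystem ω (fun i => e i + m i • e k)
      (Function.update f k (f k - ∑ l, m l • f l)) where
  left i j := by simp [h.left]
  right i j := by
    by_cases hik : i = k <;> by_cases hjk : j = k <;>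
      simp [hik, hjk, h.right]
  pair i j := by
    rcases eq_or_ne j k with rfl | hjk
    · simp [h.pair, hk]
    · simp [hjk, h.pair, hjk.symm]

end IsSymplecticSystem

/-! ### Reduction theory of symplectic lattices in a Hermitian space -/

section Hermitian

variable {E : Type*} [NormedAddCommGroup E] [InnerProductSpace ℂ E]

/-- The imaginary part of the inner product, as an alternating form on the underlying abelian
group. -/
noncomputable def imInner (E : Type*) [NormedAddCommGroup E] [InnerProductSpace ℂ E] :
    E →ₗ[ℤ] E →ₗ[ℤ] ℝ :=
  LinearMap.mk₂ ℤ (fun x y => (inner ℂ x y).im) (by simp)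
    (fun m x y => by simp [← Int.cast_smul_eq_zsmul ℂ m, mul_comm]) (by simp)
    (fun m x y => by simp [← Int.cast_smul_eq_zsmul ℂ m])

theorem imInner_apply (x y : E) : imInner E x y = (inner ℂ x y).im := rfl

theorem imInner_isAlt : (imInner E).IsAlt := fun x => by
  rw [imInner_apply, inner_self_eq_norm_sq_to_K]
  norm_cast

theorem abs_imInner_le (x y : E) : |imInner E x y| ≤ ‖x‖ * ‖y‖ :=
  (Complex.abs_im_le_norm _).trans (norm_inner_le_norm x y)

theorem IsSymplecticSystem.exists_le_norm {ι : Type*} [Finite ι] [DecidableEq ι] {e f : ι → E}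
    (h : IsSymplecticSystem (imInner E) e f) :
    ∃ δ > 0, ∀ x ∈ systemLattice e f, ∀ y ∈ systemLattice e f, imInner E x y ≠ 0 → δ ≤ ‖x‖ := by
  obtain ⟨M, hM0, hM⟩ := (Set.finite_range (Sum.elim e f)).isBounded.exists_pos_norm_le
  refine ⟨1 / M, by positivity, fun x hx y hy hxy => ?_⟩
  obtain ⟨z, hz, hxz⟩ : ∃ z ∈ Set.range (Sum.elim e f), imInner E x z ≠ 0 := by
    by_contra! h0
    exact hxy (Submodule.span_le (p := LinearMap.ker (imInner E x)).2 h0 hy)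
  obtain ⟨m, hm⟩ := h.exists_int_apply imInner_isAlt hx (Submodule.subset_span hz)
  have hm1 : (1 : ℝ) ≤ |(m : ℝ)| := by
    rw [hm, Int.cast_ne_zero] at hxz
    exact_mod_cast Int.one_le_abs hxz
  rw [div_le_iff₀ hM0]
  calc (1 : ℝ) ≤ |(m : ℝ)| := hm1
    _ ≤ ‖x‖ * ‖z‖ := hm ▸ abs_imInner_le x z
    _ ≤ ‖x‖ * M := by gcongr; exact hM z hz

theorem IsSymplecticSystem.exists_nearly_minimal {ι : Type*} [Finite ι] [DecidableEq ι]
    {e f : ι → E} (h : IsSymplecticSystem (imInner E) e f) (i : ι) :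
    ∃ a b : ι → E, IsSymplecticSystem (imInner E) a b ∧ systemLattice a b ≤ systemLattice e f ∧
      ∀ c d : ι → E, IsSymplecticSystem (imInner E) c d → systemLattice c d ≤ systemLattice a b →
        ‖a i‖ ^ 2 ≤ 2 * ‖c i‖ ^ 2 := by
  obtain ⟨δ, hδ, hδ_le⟩ := h.exists_le_norm
  set S : Set ℝ := {t | ∃ a b : ι → E, IsSymplecticSystem (imInner E) a b ∧
    systemLattice a b ≤ systemLattice e f ∧ ‖a i‖ ^ 2 = t}
  have hS : ∀ t ∈ S, δ ^ 2 ≤ t := by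
    rintro _ ⟨a, b, hab, hle, rfl⟩
    gcongr
    exact hδ_le _ (hle (left_mem_systemLattice a b i)) _ (hle (right_mem_systemLattice a b i))
      (by simp [hab.pair])
  have hS_ne : S.Nonempty := ⟨_, e, f, h, le_rfl, rfl⟩
  have hS_pos : 0 < sInf S := (by positivity : 0 < δ ^ 2).trans_le (le_csInf hS_ne hS)
  obtain ⟨_, ⟨a, b, hab, hle, rfl⟩, hlt⟩ :=
    exists_lt_of_csInf_lt hS_ne (show sInf S < 2 * sInf S by linarith)
  refine ⟨a, b, hab, hle, fun c d hcd hcd_le => ?_⟩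
  have : sInf S ≤ ‖c i‖ ^ 2 := csInf_le ⟨δ ^ 2, hS⟩ ⟨c, d, hcd, hcd_le.trans hle, rfl⟩
  linarith

/-- The orthogonal projection onto the complement of the complex line through `u`. -/
noncomputable def projCompl (u : E) : E →L[ℂ] (ℂ ∙ u)ᗮ := (ℂ ∙ u)ᗮ.orthogonalProjectionOnto

theorem projCompl_self (u : E) : projCompl u u = 0 :=
  Submodule.orthogonalProjectionOnto_orthogonalComplement_singleton_eq_zero u

theorem inner_projCompl (u x y : E) :
    inner ℂ (projCompl u x) (projCompl u y) =
      inner ℂ x y - inner ℂ x u * inner ℂ u y / (‖u‖ ^ 2 : ℝ) := by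
  rw [projCompl, Submodule.inner_orthogonalProjectionOnto_eq_of_mem_left,
    ← Submodule.starProjection_apply, Submodule.starProjection_orthogonal_val,
    Submodule.starProjection_singleton, inner_sub_left, inner_smul_left, map_div₀, inner_conj_symm]
  simp [div_mul_eq_mul_div]

theorem imInner_projCompl {u x y : E} (hx : imInner E u x = 0) (hy : imInner E u y = 0) :
    imInner (ℂ ∙ u)ᗮ (projCompl u x) (projCompl u y) = imInner E x y := by
  have hx' : imInner E x u = 0 := imInner_isAlt.isRefl _ _ hx
  simp only [imInner_apply] at hx' hy ⊢
  rw [inner_projCompl, Complex.sub_im, Complex.div_ofReal_im, Complex.mul_im, hx', hy]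
  simp

theorem norm_sq_eq_norm_sq_projCompl_add (u x : E) :
    ‖x‖ ^ 2 = ‖projCompl u x‖ ^ 2 + ‖inner ℂ u x‖ ^ 2 / ‖u‖ ^ 2 := by
  rw [Submodule.norm_sq_eq_add_norm_sq_starProjection x (ℂ ∙ u), add_comm,
    Submodule.starProjection_singleton, norm_smul]
  rcases eq_or_ne u 0 with rfl | hu
  · simp [projCompl]
  · simp [projCompl]
    field_simp

theorem exists_norm_sq_add_zsmul_le {u : E} (hu : u ≠ 0) (x : E) :
    ∃ m : ℤ, ‖x + m • u‖ ^ 2 ≤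
      ‖projCompl u x‖ ^ 2 + ‖u‖ ^ 2 / 4 + imInner E u x ^ 2 / ‖u‖ ^ 2 := by
  have : 0 < ‖u‖ ^ 2 := by positivity
  set t : ℝ := (inner ℂ u x).re / ‖u‖ ^ 2 with ht
  refine ⟨-round t, ?_⟩
  have h_round : (t - round t) ^ 2 ≤ 1 / 4 := by
    nlinarith [abs_sub_round t, abs_nonneg (t - round t), sq_abs (t - round t)]
  have h_proj : projCompl u (x + (-round t) • u) = projCompl u x := by
    simp [projCompl_self]
  have h_inner : ‖inner ℂ u (x + (-round t) • u)‖ ^ 2 =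
      ((t - round t) * ‖u‖ ^ 2) ^ 2 + imInner E u x ^ 2 := by
    have h_re : (inner ℂ u x).re = t * ‖u‖ ^ 2 := by rw [ht]; field_simp
    have h_expand : inner ℂ u (x + (-round t) • u) =
        inner ℂ u x + ((-round t * ‖u‖ ^ 2 : ℝ) : ℂ) := by
      rw [← Int.cast_smul_eq_zsmul ℂ (-round t), inner_add_right, inner_smul_right,
        inner_self_eq_norm_sq_to_K]
      simp
    rw [h_expand, Complex.sq_norm, Complex.normSq_apply, Complex.add_re, Complex.add_im,
      Complex.ofReal_re, Complex.ofReal_im, h_re, imInner_apply]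
    ring
  calc ‖x + (-round t) • u‖ ^ 2
      = ‖projCompl u x‖ ^ 2 + (t - round t) ^ 2 * ‖u‖ ^ 2 + imInner E u x ^ 2 / ‖u‖ ^ 2 := by
        rw [norm_sq_eq_norm_sq_projCompl_add u, h_proj, h_inner]
        field_simp
        ring
    _ ≤ ‖projCompl u x‖ ^ 2 + 1 / 4 * ‖u‖ ^ 2 + imInner E u x ^ 2 / ‖u‖ ^ 2 := by gcongr
    _ = ‖projCompl u x‖ ^ 2 + ‖u‖ ^ 2 / 4 + imInner E u x ^ 2 / ‖u‖ ^ 2 := by ring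

namespace IsSymplecticSystem

variable {n : ℕ} {e f : Fin (n + 1) → E}

theorem imInner_left_zero_tail (h : IsSymplecticSystem (imInner E) e f) :
    ∀ z ∈ systemLattice (e ∘ Fin.succ) (f ∘ Fin.succ), imInner E (e 0) z = 0 :=
  systemLattice_le (Λ := LinearMap.ker (imInner E (e 0))).2
    ⟨fun _ => h.left _ _, fun j => by simp [h.pair, (Fin.succ_ne_zero j).symm]⟩

theorem imInner_right_zero_tail (h : IsSymplecticSystem (imInner E) e f) :
    ∀ z ∈ systemLattice (e ∘ Fin.succ) (f ∘ Fin.succ), imInner E (f 0) z = 0 :=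
  systemLattice_le (Λ := LinearMap.ker (imInner E (f 0))).2
    ⟨fun j => by simp [h.pair_swap imInner_isAlt, (Fin.succ_ne_zero j).symm],
      fun _ => h.right _ _⟩

theorem projCompl_tail (h : IsSymplecticSystem (imInner E) e f) :
    IsSymplecticSystem (imInner (ℂ ∙ e 0)ᗮ) (fun i : Fin n => projCompl (e 0) (e i.succ))
      (fun i => projCompl (e 0) (f i.succ)) := by
  have h_tail := h.comp_injective (Fin.succ_injective n)
  have h_im {x y : E} (hx : x ∈ systemLattice (e ∘ Fin.succ) (f ∘ Fin.succ))
      (hy : y ∈ systemLattice (e ∘ Fin.succ) (f ∘ Fin.succ)) :=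
    imInner_projCompl (h.imInner_left_zero_tail x hx) (h.imInner_left_zero_tail y hy)
  have he := left_mem_systemLattice (e ∘ Fin.succ) (f ∘ Fin.succ)
  have hf := right_mem_systemLattice (e ∘ Fin.succ) (f ∘ Fin.succ)
  exact ⟨fun i j => (h_im (he i) (he j)).trans (h_tail.left i j),
    fun i j => (h_im (hf i) (hf j)).trans (h_tail.right i j),
    fun i j => (h_im (he i) (hf j)).trans (h_tail.pair i j)⟩

theorem exists_lift_projCompl (h : IsSymplecticSystem (imInner E) e f)
    {e' f' : Fin n → (ℂ ∙ e 0)ᗮ} (h' : IsSymplecticSystem (imInner (ℂ ∙ e 0)ᗮ) e' f')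
    (hle : systemLattice e' f' ≤ systemLattice (fun i : Fin n => projCompl (e 0) (e i.succ))
      (fun i => projCompl (e 0) (f i.succ))) :
    ∃ x y : Fin n → E, IsSymplecticSystem (imInner E) x y ∧
      systemLattice x y ≤ systemLattice (e ∘ Fin.succ) (f ∘ Fin.succ) ∧
      ∀ i, projCompl (e 0) (x i) = e' i := by
  rw [systemLattice_le] at hle
  have h_map := systemLattice_map ((projCompl (e 0)).toLinearMap.restrictScalars ℤ)
    (e ∘ Fin.succ) (f ∘ Fin.succ)
  simp only [Function.comp_apply, LinearMap.coe_restrictScalars, ContinuousLinearMap.coe_coe]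
    at h_map
  rw [h_map] at hle
  choose x hx hxe using hle.1
  choose y hy hyf using hle.2
  have h_im {v w : E} (hv : v ∈ systemLattice (e ∘ Fin.succ) (f ∘ Fin.succ))
      (hw : w ∈ systemLattice (e ∘ Fin.succ) (f ∘ Fin.succ)) :=
    imInner_projCompl (h.imInner_left_zero_tail v hv) (h.imInner_left_zero_tail w hw)
  have hxe' (i) : projCompl (e 0) (x i) = e' i := hxe i
  have hyf' (i) : projCompl (e 0) (y i) = f' i := hyf i
  refine ⟨x, y, ⟨fun i j => ?_, fun i j => ?_, fun i j => ?_⟩, systemLattice_le.2 ⟨hx, hy⟩, hxe'⟩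
  · rw [← h_im (hx i) (hx j), hxe', hxe', h'.left]
  · rw [← h_im (hy i) (hy j), hyf', hyf', h'.right]
  · rw [← h_im (hx i) (hy j), hxe', hyf', h'.pair]

/-- A symplectic system in the projected lattice lifts to a system containing `e 0`; a transvection
along `e 0` size-reduces the other left vectors. -/
theorem exists_size_reduced_lift (h : IsSymplecticSystem (imInner E) e f)
    {e' f' : Fin n → (ℂ ∙ e 0)ᗮ} (h' : IsSymplecticSystem (imInner (ℂ ∙ e 0)ᗮ) e' f')
    (hle : systemLattice e' f' ≤ systemLattice (fun i : Fin n => projCompl (e 0) (e i.succ))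
      (fun i => projCompl (e 0) (f i.succ))) :
    ∃ a b : Fin (n + 1) → E, IsSymplecticSystem (imInner E) a b ∧
      systemLattice a b ≤ systemLattice e f ∧ a 0 = e 0 ∧
      ∀ i : Fin n, ‖a i.succ‖ ^ 2 ≤ ‖e' i‖ ^ 2 + ‖e 0‖ ^ 2 / 4 := by
  obtain ⟨x, y, hxy, hxy_le, hx⟩ := h.exists_lift_projCompl h' hle
  choose m hm using fun i => exists_norm_sq_add_zsmul_le (h.left_ne_zero 0) (x i)
  have h_cons := hxy.cons imInner_isAlt (u := e 0) (v := f 0) (by simp [h.pair])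
    (fun z hz => h.imInner_left_zero_tail z (hxy_le hz))
    (fun z hz => h.imInner_right_zero_tail z (hxy_le hz))
  refine ⟨_, _, h_cons.transvection (m := Fin.cons 0 m) (k := 0) rfl,
    (systemLattice_transvection_le _ _ _ _).trans (systemLattice_cons_le hxy_le), by simp,
    fun i => ?_⟩
  have h_im : imInner E (e 0) (x i) = 0 :=
    h.imInner_left_zero_tail _ (hxy_le (left_mem_systemLattice x y i))
  simpa [hx, h_im] using hm i

theorem norm_sq_le_two_of_minimal {e f : Fin 1 → E} (hE : Module.finrank ℂ E = 1)
    (h : IsSymplecticSystem (imInner E) e f)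
    (h_min : ∀ c d : Fin 1 → E, IsSymplecticSystem (imInner E) c d →
      systemLattice c d ≤ systemLattice e f → ‖e 0‖ ^ 2 ≤ 2 * ‖c 0‖ ^ 2) : ‖e 0‖ ^ 2 ≤ 2 := by
  have he := h.left_ne_zero 0
  obtain ⟨m, hm⟩ := exists_norm_sq_add_zsmul_le he (f 0)
  have h_proj : projCompl (e 0) (f 0) = 0 := by
    have : FiniteDimensional ℂ E := Module.finite_of_finrank_eq_succ hE
    have : Fact (Module.finrank ℂ E = 0 + 1) := ⟨hE⟩
    have := Module.finrank_zero_iff.1 (Submodule.finrank_orthogonal_span_singleton (𝕜 := ℂ) he)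
    exact Subsingleton.elim _ _
  rw [h_proj, h.pair] at hm
  have h_le := h_min _ _ (h.swap imInner_isAlt m) (systemLattice_le.2
    ⟨fun i => add_mem (right_mem_systemLattice e f i)
      (Submodule.smul_mem _ _ (left_mem_systemLattice e f i)),
      fun i => neg_mem (left_mem_systemLattice e f i)⟩)
  have : 0 < ‖e 0‖ ^ 2 := by positivity
  have h_ineq : ‖e 0‖ ^ 2 ≤ 2 * (‖e 0‖ ^ 2 / 4 + 1 / ‖e 0‖ ^ 2) := by
    refine h_le.trans ?_
    simpa using hm
  have h_sq : ‖e 0‖ ^ 2 * ‖e 0‖ ^ 2 ≤ 2 * 2 := by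
    field_simp at h_ineq
    nlinarith
  nlinarith

end IsSymplecticSystem

end Hermitian

/-- The bound for the squared lengths of the left vectors of a reduced symplectic system of
rank `2n`. -/
def reductionConst : ℕ → ℝ
  | 0 => 0
  | n + 1 => 4 * reductionConst n + 2

theorem reductionConst_nonneg (n : ℕ) : 0 ≤ reductionConst n := by
  induction n with
  | zero => exact le_rfl
  | succ n ih => rw [reductionConst]; positivity

/-- The idea of Lagrange and Hermite: a nearly shortest left vector, completed by a reduced system
of the projected lattice, cannot be much longer than the next vector. -/
theorem IsSymplecticSystem.exists_reduced.{u} (n : ℕ) {E : Type u} [NormedAddCommGroup E]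
    [InnerProductSpace ℂ E] (hE : Module.finrank ℂ E = n)
    {e f : Fin n → E} (h : IsSymplecticSystem (imInner E) e f) :
    ∃ a b : Fin n → E, IsSymplecticSystem (imInner E) a b ∧
      systemLattice a b ≤ systemLattice e f ∧ ∀ i, ‖a i‖ ^ 2 ≤ reductionConst n := by
  induction n generalizing E with
  | zero => exact ⟨e, f, h, le_rfl, fun i => i.elim0⟩
  | succ n ih =>
    obtain ⟨e₁, f₁, h₁, h₁_le, h_min⟩ := h.exists_nearly_minimal 0
    have hu := h₁.left_ne_zero 0
    have h_finrank : Module.finrank ℂ (ℂ ∙ e₁ 0)ᗮ = n :=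
      haveI : Fact (Module.finrank ℂ E = n + 1) := ⟨hE⟩
      Submodule.finrank_orthogonal_span_singleton hu
    obtain ⟨e', f', h', h'_le, h'_norm⟩ := ih h_finrank h₁.projCompl_tail
    obtain ⟨a, b, hab, hab_le, ha_zero, ha_succ⟩ := h₁.exists_size_reduced_lift h' h'_le
    have hC := reductionConst_nonneg n
    have h_zero : ‖e₁ 0‖ ^ 2 ≤ reductionConst (n + 1) := by
      rw [reductionConst]
      cases n with
      | zero => linarith [h₁.norm_sq_le_two_of_minimal hE h_min]
      | succ n =>
        have h_swap := h_min _ _ (hab.comp_injective (Equiv.swap 0 1).injective)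
          ((systemLattice_comp_le a b _).trans hab_le)
        rw [Function.comp_apply, Equiv.swap_apply_left, ← Fin.succ_zero_eq_one] at h_swap
        linarith [ha_succ 0, h'_norm 0]
    refine ⟨a, b, hab, hab_le.trans h₁_le, Fin.cases (by rwa [ha_zero]) fun i => ?_⟩
    rw [reductionConst] at h_zero ⊢
    linarith [ha_succ i, h'_norm i]

/-! ### Reduction of symplectic matrices modulo `Sp_{2n}(ℤ)` -/

section Rows

open SiegelUpperHalfSpace

variable {n : ℕ}

/-- The identification `(c, d) ↦ ci + d` of `ℝ^{2n}` with `ℂ^n`, which maps the lower rows of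
`g ∈ Sp_{2n}(ℝ)` to the rows of `J(g, i)`. -/
noncomputable def rowToComplex (n : ℕ) :
    (Fin n ⊕ Fin n → ℝ) →ₗ[ℝ] EuclideanSpace ℂ (Fin n) where
  toFun v := WithLp.toLp 2 fun j => (v (Sum.inl j) : ℂ) * Complex.I + v (Sum.inr j)
  map_add' v w := by ext j; simp; ring
  map_smul' c v := by ext j; simp; ring

theorem rowToComplex_apply (v : Fin n ⊕ Fin n → ℝ) (j : Fin n) :
    rowToComplex n v j = (v (Sum.inl j) : ℂ) * Complex.I + v (Sum.inr j) := rfl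

theorem denomMatrix_basePoint_apply (g : Sp n ℝ) (i j : Fin n) :
    denomMatrix g (basePoint n) i j = rowToComplex n (g.1 (Sum.inr i)) j := by
  simp [denomMatrix, basePoint, blockC, blockD, rowToComplex_apply, toBlocks₂₁, toBlocks₂₂,
    mul_comm]

theorem imInner_rowToComplex (v w : Fin n ⊕ Fin n → ℝ) :
    imInner _ (rowToComplex n v) (rowToComplex n w) = v ⬝ᵥ (J (Fin n) ℝ *ᵥ w) := by
  rw [imInner_apply, PiLp.inner_apply, Complex.im_sum]
  simp only [J, dotProduct, fromBlocks_mulVec, Fintype.sum_sum_type, Sum.elim_inl, Sum.elim_inr,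
    ← Finset.sum_add_distrib]
  refine Finset.sum_congr rfl fun j _ => ?_
  simp [rowToComplex_apply, neg_mulVec]
  ring

theorem imInner_rowToComplex_rows (M : Matrix (Fin n ⊕ Fin n) (Fin n ⊕ Fin n) ℝ)
    (s t : Fin n ⊕ Fin n) :
    imInner _ (rowToComplex n (M s)) (rowToComplex n (M t)) = (M * J (Fin n) ℝ * Mᵀ) s t := by
  rw [imInner_rowToComplex, Matrix.mul_assoc, Matrix.mul_apply_eq_vecMul]
  rfl

theorem isSymplecticSystem_rows_iff {M : Matrix (Fin n ⊕ Fin n) (Fin n ⊕ Fin n) ℝ} :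
    IsSymplecticSystem (imInner _) (fun i => rowToComplex n (M (Sum.inr i)))
      (fun i => rowToComplex n (M (Sum.inl i))) ↔ M ∈ symplecticGroup (Fin n) ℝ := by
  rw [SymplecticGroup.mem_iff]
  constructor
  · intro h
    ext (i | i) (j | j) <;> rw [← imInner_rowToComplex_rows]
    · simp [J, h.right]
    · simp [J, h.pair_swap imInner_isAlt, one_apply, eq_comm, apply_ite]
    · simp [J, h.pair, one_apply]
    · simp [J, h.left]
  · intro h
    refine ⟨fun i j => ?_, fun i j => ?_, fun i j => ?_⟩ <;>
      rw [imInner_rowToComplex_rows, h] <;> simp [J, one_apply]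

theorem exists_int_vecMul_of_mem_systemLattice_rows
    {M : Matrix (Fin n ⊕ Fin n) (Fin n ⊕ Fin n) ℝ} {y : EuclideanSpace ℂ (Fin n)}
    (hy : y ∈ systemLattice (fun i => rowToComplex n (M (Sum.inr i)))
      (fun i => rowToComplex n (M (Sum.inl i)))) :
    ∃ c : Fin n ⊕ Fin n → ℤ, rowToComplex n ((fun s => (c s : ℝ)) ᵥ* M) = y := by
  have h_rows : Set.range (Sum.elim (fun i => rowToComplex n (M (Sum.inr i)))
      fun i => rowToComplex n (M (Sum.inl i))) = Set.range fun s => rowToComplex n (M s) := by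
    ext
    simp [or_comm]
  rw [systemLattice, h_rows, Submodule.mem_span_range_iff_exists_fun] at hy
  obtain ⟨c, rfl⟩ := hy
  refine ⟨c, ?_⟩
  rw [vecMul_eq_sum, map_sum]
  exact Finset.sum_congr rfl fun s _ => by rw [Int.cast_smul_eq_zsmul, map_zsmul]

theorem mem_symplecticGroup_of_map {R S : Type*} [CommRing R] [CommRing S] {f : R →+* S}
    (hf : Function.Injective f) {M : Matrix (Fin n ⊕ Fin n) (Fin n ⊕ Fin n) R}
    (hM : M.map f ∈ symplecticGroup (Fin n) S) : M ∈ symplecticGroup (Fin n) R := by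
  rw [SymplecticGroup.mem_iff] at hM ⊢
  apply Matrix.map_injective hf
  simpa only [Matrix.map_mul, Matrix.map_J, Matrix.transpose_map] using hM

theorem exists_spMap_mul_denomMatrix_le (g : Sp n ℝ) : ∃ γ : Sp n ℤ, ∀ i,
    ∑ j, ‖denomMatrix (spMap (Int.castRingHom ℝ) γ * g) (basePoint n) i j‖ ^ 2 ≤
      reductionConst n := by
  obtain ⟨a, b, hab, h_le, h_bound⟩ := IsSymplecticSystem.exists_reduced n
    (finrank_euclideanSpace_fin (𝕜 := ℂ)) (isSymplecticSystem_rows_iff.2 g.2)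
  rw [systemLattice_le] at h_le
  choose ca hca using fun i => exists_int_vecMul_of_mem_systemLattice_rows (h_le.1 i)
  choose cb hcb using fun i => exists_int_vecMul_of_mem_systemLattice_rows (h_le.2 i)
  set γ : Matrix (Fin n ⊕ Fin n) (Fin n ⊕ Fin n) ℤ := Matrix.of (Sum.elim cb ca)
  have ha (i) : rowToComplex n ((γ.map (Int.castRingHom ℝ) * g.1) (Sum.inr i)) = a i :=
    (congrArg _ (Matrix.mul_apply_eq_vecMul ..)).trans (hca i)
  have hb (i) : rowToComplex n ((γ.map (Int.castRingHom ℝ) * g.1) (Sum.inl i)) = b i :=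
    (congrArg _ (Matrix.mul_apply_eq_vecMul ..)).trans (hcb i)
  have hγg : γ.map (Int.castRingHom ℝ) * g.1 ∈ symplecticGroup (Fin n) ℝ := by
    rw [← isSymplecticSystem_rows_iff]
    simpa only [ha, hb] using hab
  have hγ : γ ∈ symplecticGroup (Fin n) ℤ := by
    apply mem_symplecticGroup_of_map (f := Int.castRingHom ℝ) Int.cast_injective
    have h_cancel : g.1 * (g⁻¹ : Sp n ℝ).1 = 1 := congrArg Subtype.val (mul_inv_cancel g)
    simpa only [Matrix.mul_assoc, h_cancel, Matrix.mul_one] using mul_mem hγg (g⁻¹).2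
  refine ⟨⟨γ, hγ⟩, fun i => (h_bound i).trans' (le_of_eq ?_)⟩
  rw [EuclideanSpace.norm_sq_eq, ← ha]
  exact Finset.sum_congr rfl fun j _ => by rw [denomMatrix_basePoint_apply]; rfl

end Rows

/-! ### Positive semidefinite matrices -/

section PosSemidef

open scoped ComplexOrder

variable {𝕜 m : Type*} [RCLike 𝕜] [Fintype m]

theorem exists_eq_conjTranspose_mul_self {A : Matrix m m 𝕜} (hA : A.PosSemidef) :
    ∃ S, A = Sᴴ * S := by
  classical
  open scoped MatrixOrder in
  exact CStarAlgebra.nonneg_iff_eq_star_mul_self.1 hA.nonneg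

theorem trace_mul_nonneg_of_posSemidef {A B : Matrix m m 𝕜} (hA : A.PosSemidef)
    (hB : B.PosSemidef) : 0 ≤ (A * B).trace := by
  obtain ⟨S, rfl⟩ := exists_eq_conjTranspose_mul_self hA
  rw [Matrix.mul_assoc, Matrix.trace_mul_comm]
  exact (hB.mul_mul_conjTranspose_same S).trace_nonneg

theorem abs_apply_le_trace_of_posSemidef {A : Matrix m m ℝ} (hA : A.PosSemidef) (i j : m) :
    |A i j| ≤ A.trace := by
  have h_le (k : m) : A k k ≤ A.trace :=
    Finset.single_le_sum (f := A.diag) (fun _ _ => hA.diag_nonneg) (Finset.mem_univ k)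
  have h_det := (hA.submatrix ![i, j]).det_nonneg
  have h_symm : A j i = A i j := hA.isHermitian.apply i j
  simp only [det_fin_two, submatrix_apply, cons_val_zero, cons_val_one, h_symm] at h_det
  refine abs_le_of_sq_le_sq ?_ hA.trace_nonneg
  nlinarith [h_le i, h_le j, hA.diag_nonneg (i := i), hA.diag_nonneg (i := j)]

variable [DecidableEq m]

theorem one_le_det_one_add_of_posSemidef {P : Matrix m m 𝕜} (hP : P.PosSemidef) :
    1 ≤ (1 + P).det := by
  have h_det : (1 + P).det = ∏ i, (1 + (hP.isHermitian.eigenvalues i : 𝕜)) := by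
    conv_lhs => rw [hP.isHermitian.spectral_theorem]
    rw [← map_one (Unitary.conjStarAlgAut 𝕜 _ hP.isHermitian.eigenvectorUnitary), ← map_add,
      Unitary.conjStarAlgAut_apply, det_mul_right_comm]
    simp [← diagonal_one, diagonal_add, det_diagonal]
  rw [h_det]
  calc (1 : 𝕜) = ∏ _i : m, 1 := Finset.prod_const_one.symm
    _ ≤ _ := Finset.prod_le_prod (fun _ _ => zero_le_one) fun i _ =>
      le_add_of_nonneg_right (by exact_mod_cast hP.eigenvalues_nonneg i)

theorem det_le_det_of_posSemidef_sub {A B : Matrix m m 𝕜} (hA : A.PosDef)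
    (hAB : (B - A).PosSemidef) : A.det ≤ B.det := by
  obtain ⟨S, rfl⟩ := exists_eq_conjTranspose_mul_self hA.posSemidef
  have h_pos := hA.det_pos
  have hS : IsUnit S.det := by
    rw [det_mul] at h_pos
    exact isUnit_iff_ne_zero.2 (right_ne_zero_of_mul h_pos.ne')
  have hP := hAB.conjTranspose_mul_mul_same S⁻¹
  have hB : B = Sᴴ * (1 + (S⁻¹)ᴴ * (B - Sᴴ * S) * S⁻¹) * S := by
    rw [Matrix.mul_add, Matrix.add_mul, Matrix.mul_one, conjTranspose_nonsing_inv,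
      ← Matrix.mul_assoc, ← Matrix.mul_assoc, Matrix.mul_nonsing_inv _ (by simpa using hS.star),
      Matrix.one_mul, Matrix.nonsing_inv_mul_cancel_right _ _ hS]
    abel
  rw [hB, det_mul_right_comm Sᴴ, det_mul _ (1 + _)]
  exact le_mul_of_one_le_right h_pos.le (one_le_det_one_add_of_posSemidef hP)

theorem posSemidef_inv_sub_inv {A B : Matrix m m 𝕜} (hA : A.PosDef) (hB : B.PosDef)
    (hAB : (B - A).PosSemidef) : (A⁻¹ - B⁻¹).PosSemidef := by
  let _ := hB.isUnit.invertible
  let _ := hA.inv.isUnit.invertible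
  -- Both differences are Schur complements of the block matrix `[B 1; 1 A⁻¹]`.
  have h_left := PosDef.fromBlocks₁₁ (1 : Matrix m m 𝕜) A⁻¹ hB
  have h_right := PosDef.fromBlocks₂₂ B (1 : Matrix m m 𝕜) hA.inv
  rw [conjTranspose_one, Matrix.one_mul, Matrix.mul_one] at h_left h_right
  rw [nonsing_inv_nonsing_inv _ ((isUnit_iff_isUnit_det _).1 hA.isUnit)] at h_right
  exact h_left.1 (h_right.2 hAB)

theorem posSemidef_trace_smul_one_sub {A : Matrix m m 𝕜} (hA : A.PosSemidef) :
    (A.trace • 1 - A).PosSemidef := by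
  set U := (hA.isHermitian.eigenvectorUnitary : Matrix m m 𝕜)
  set D : Matrix m m 𝕜 := diagonal (RCLike.ofReal ∘ hA.isHermitian.eigenvalues)
  have h_spec : A = U * D * Uᴴ := by
    conv_lhs => rw [hA.isHermitian.spectral_theorem, Unitary.conjStarAlgAut_apply]
    rfl
  have hU : U * Uᴴ = 1 := Unitary.coe_mul_star_self _
  have h_diag : (A.trace • 1 - D).PosSemidef := by
    rw [smul_one_eq_diagonal, diagonal_sub, posSemidef_diagonal_iff]
    intro i
    rw [hA.isHermitian.trace_eq_sum_eigenvalues, sub_nonneg]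
    exact Finset.single_le_sum (f := RCLike.ofReal ∘ hA.isHermitian.eigenvalues)
      (fun j _ => RCLike.ofReal_nonneg.2 (hA.eigenvalues_nonneg j)) (Finset.mem_univ i)
  have h_conj : A.trace • 1 - A = U * (A.trace • 1 - D) * Uᴴ := by
    rw [Matrix.mul_sub, Matrix.sub_mul, ← h_spec, Matrix.mul_smul, Matrix.mul_one,
      Matrix.smul_mul, hU]
  rw [h_conj]
  exact h_diag.mul_mul_conjTranspose_same U

end PosSemidef

/-! ### The factor of automorphy at the base point -/

section Automorphy

open SiegelUpperHalfSpace

variable {n : ℕ}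

theorem sub_conjTranspose_eq_imPart (Z : SiegelUpperHalfSpace n) :
    (Z : Matrix (Fin n) (Fin n) ℂ) - (Z : Matrix (Fin n) (Fin n) ℂ)ᴴ =
      (2 * Complex.I) • (imPart Z).map Complex.ofReal := by
  ext i j
  rw [Matrix.sub_apply, conjTranspose_apply, Z.2.1.apply i j, Matrix.smul_apply, map_apply, imPart,
    map_apply, smul_eq_mul]
  apply Complex.ext <;> simp
  ring

theorem imPart_basePoint : imPart (basePoint n) = 1 := by
  ext i j
  by_cases hij : i = j <;> simp [imPart, basePoint, Matrix.one_apply, hij]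

theorem act_mul_denomMatrix (g : Sp n ℝ) (Z : SiegelUpperHalfSpace n) :
    (act g Z : Matrix (Fin n) (Fin n) ℂ) * denomMatrix g Z = numMatrix g Z :=
  nonsing_inv_mul_cancel_right _ _ (isUnit_det_denom g Z)

theorem conjTranspose_denomMatrix_mul_imPart_act (g : Sp n ℝ) (Z : SiegelUpperHalfSpace n) :
    (denomMatrix g Z)ᴴ * (imPart (act g Z)).map Complex.ofReal * denomMatrix g Z =
      (imPart Z).map Complex.ofReal := by
  have h := denom_star_mul_num g Z
  rw [← act_mul_denomMatrix, conjTranspose_mul, ← Matrix.mul_assoc, ← Matrix.sub_mul,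
    ← Matrix.mul_sub, sub_conjTranspose_eq_imPart, Matrix.mul_smul, Matrix.smul_mul] at h
  exact smul_right_injective _ (by simp : 2 * Complex.I ≠ 0) h

/-- The Gram matrix `CCᵀ + DDᵀ` of the lower rows of `g = [A B; C D]`. -/
def lowerGram (g : Sp n ℝ) : Matrix (Fin n) (Fin n) ℝ := g.1.toRows₂ * g.1.toRows₂ᵀ

theorem denomMatrix_mul_conjTranspose (g : Sp n ℝ) :
    denomMatrix g (basePoint n) * (denomMatrix g (basePoint n))ᴴ =
      (lowerGram g).map Complex.ofReal := by
  ext i j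
  have h_inner : (denomMatrix g (basePoint n) * (denomMatrix g (basePoint n))ᴴ) i j =
      inner ℂ (rowToComplex n (g.1 (Sum.inr j))) (rowToComplex n (g.1 (Sum.inr i))) := by
    simp only [Matrix.mul_apply, conjTranspose_apply, denomMatrix_basePoint_apply,
      PiLp.inner_apply, RCLike.inner_apply]
    rfl
  rw [h_inner]
  apply Complex.ext
  · rw [PiLp.inner_apply, Complex.re_sum, map_apply, Complex.ofReal_re]
    simp only [lowerGram, Matrix.mul_apply, Fintype.sum_sum_type, toRows₂_apply, transpose_apply,
      ← Finset.sum_add_distrib]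
    refine Finset.sum_congr rfl fun k _ => ?_
    simp [rowToComplex_apply]
    ring
  · exact (isSymplecticSystem_rows_iff.2 g.2).left j i

theorem norm_det_denomMatrix_sq (g : Sp n ℝ) :
    ‖(denomMatrix g (basePoint n)).det‖ ^ 2 = (lowerGram g).det := by
  have h := congrArg det (denomMatrix_mul_conjTranspose g)
  have h_map : ((lowerGram g).map Complex.ofReal).det = ((lowerGram g).det : ℂ) :=
    (RingHom.map_det Complex.ofRealHom _).symm
  rw [det_mul, det_conjTranspose, Complex.star_def, Complex.mul_conj, h_map,
    Complex.ofReal_inj] at h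
  rw [← h, Complex.normSq_eq_norm_sq]

theorem lowerGram_posDef (g : Sp n ℝ) : (lowerGram g).PosDef := by
  have h : (lowerGram g).PosSemidef := posSemidef_self_mul_conjTranspose _
  rw [h.posDef_iff_det_ne_zero, ← norm_det_denomMatrix_sq]
  exact pow_ne_zero 2 (norm_ne_zero_iff.2 (isUnit_det_denom g _).ne_zero)

theorem inv_imPart_act_basePoint (g : Sp n ℝ) :
    (imPart (act g (basePoint n)))⁻¹ = lowerGram g := by
  have h := conjTranspose_denomMatrix_mul_imPart_act g (basePoint n)
  have h_one : (1 : Matrix (Fin n) (Fin n) ℝ).map Complex.ofReal = 1 :=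
    Matrix.map_one _ Complex.ofReal_zero Complex.ofReal_one
  rw [imPart_basePoint, h_one, mul_eq_one_comm, ← Matrix.mul_assoc,
    denomMatrix_mul_conjTranspose] at h
  refine Matrix.inv_eq_left_inv (Matrix.map_injective Complex.ofReal_injective ?_)
  beta_reduce
  rw [h_one, ← h]
  exact Matrix.map_mul (f := Complex.ofRealHom)

theorem trace_lowerGram (g : Sp n ℝ) :
    (lowerGram g).trace = ∑ i, ∑ j, ‖denomMatrix g (basePoint n) i j‖ ^ 2 := by
  have h := congrArg trace (denomMatrix_mul_conjTranspose g)
  apply Complex.ofReal_injective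
  simpa [trace, Matrix.mul_apply, Complex.mul_conj, Complex.normSq_eq_norm_sq] using h.symm

/-- A weak form of Siegel's reduction theory. -/
theorem exists_trace_inv_imPart_act_le (g : Sp n ℝ) : ∃ γ : Sp n ℤ,
    (imPart (act (spMap (Int.castRingHom ℝ) γ * g) (basePoint n)))⁻¹.trace ≤
      n * reductionConst n := by
  obtain ⟨γ, hγ⟩ := exists_spMap_mul_denomMatrix_le g
  refine ⟨γ, ?_⟩
  rw [inv_imPart_act_basePoint, trace_lowerGram]
  simpa using Finset.sum_le_sum fun i (_ : i ∈ Finset.univ) => hγ i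

theorem traceNorm_nonneg (g : Sp n ℝ) : 0 ≤ traceNorm g :=
  (posSemidef_conjTranspose_mul_self g.1).trace_nonneg

theorem traceNorm_inv (g : Sp n ℝ) : traceNorm g⁻¹ = traceNorm g := by
  have hJ : J (Fin n) ℝ * (J (Fin n) ℝ)ᵀ = 1 := by simp [J_transpose, J_squared]
  have h_inv : (g⁻¹).1 = (J (Fin n) ℝ)ᵀ * g.1ᵀ * J (Fin n) ℝ := by
    rw [SymplecticGroup.coe_inv, J_transpose]
  calc ((g⁻¹).1ᵀ * (g⁻¹).1).trace
      = ((J (Fin n) ℝ)ᵀ * (g.1 * (J (Fin n) ℝ * (J (Fin n) ℝ)ᵀ) * g.1ᵀ * J (Fin n) ℝ)).trace := by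
        rw [h_inv]
        simp only [transpose_mul, transpose_transpose, Matrix.mul_assoc]
    _ = (g.1 * (g.1ᵀ * (J (Fin n) ℝ * (J (Fin n) ℝ)ᵀ))).trace := by
        rw [Matrix.trace_mul_comm]
        simp only [hJ, Matrix.mul_one, Matrix.mul_assoc]
    _ = (g.1ᵀ * g.1).trace := by rw [hJ, Matrix.mul_one, Matrix.trace_mul_comm]

/-- For symplectic `g` the matrix `g gᵀ` is bounded below by `Tr(g* g)⁻¹`, because its inverse has
trace `Tr(g* g)`. -/
theorem posSemidef_traceNorm_smul_mul_transpose_sub_one (g : Sp n ℝ) :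
    (traceNorm g • (g.1 * g.1ᵀ) - 1).PosSemidef := by
  have h_cancel : g.1 * (g⁻¹).1 = 1 := congrArg Subtype.val (mul_inv_cancel g)
  have h_trace : ((g⁻¹).1 * (g⁻¹).1ᵀ).trace = traceNorm g := by
    rw [← traceNorm_inv, Matrix.trace_mul_comm]
    rfl
  have h := (posSemidef_trace_smul_one_sub
    (posSemidef_self_mul_conjTranspose (g⁻¹).1)).mul_mul_conjTranspose_same g.1
  simp only [conjTranspose_eq_transpose_of_trivial, h_trace] at h
  rwa [Matrix.mul_sub, Matrix.sub_mul, ← Matrix.mul_assoc, h_cancel, Matrix.one_mul,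
    ← transpose_mul, h_cancel, transpose_one, Matrix.mul_smul, Matrix.mul_one,
    Matrix.smul_mul] at h

theorem one_le_traceNorm [NeZero n] (g : Sp n ℝ) : 1 ≤ traceNorm g := by
  have h := (posSemidef_traceNorm_smul_mul_transpose_sub_one g).trace_nonneg
  have h_trace : (g.1 * g.1ᵀ).trace = traceNorm g := Matrix.trace_mul_comm _ _
  have hn : (1 : ℝ) ≤ n := by exact_mod_cast NeZero.one_le
  rw [Matrix.trace_sub, trace_smul, h_trace, trace_one, Fintype.card_sum, Fintype.card_fin,
    smul_eq_mul] at h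
  push_cast at h
  nlinarith [traceNorm_nonneg g]

theorem one_le_det_lowerGram_spMap_intCast (γ : Sp n ℤ) :
    1 ≤ (lowerGram (spMap (Int.castRingHom ℝ) γ)).det := by
  have h_int : (lowerGram (spMap (Int.castRingHom ℝ) γ)).det =
      ((γ.1.toRows₂ * γ.1.toRows₂ᵀ).det : ℤ) := by
    rw [← eq_intCast (Int.castRingHom ℝ), RingHom.map_det, RingHom.mapMatrix_apply,
      Matrix.map_mul]
    rfl
  have h_pos := (lowerGram_posDef (spMap (Int.castRingHom ℝ) γ)).det_pos
  rw [h_int] at h_pos ⊢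
  exact_mod_cast h_pos

theorem one_le_traceNorm_pow_mul_norm_det_sq [NeZero n] (γ : Sp n ℤ) (g : Sp n ℝ) :
    1 ≤ traceNorm g ^ n *
      ‖(denomMatrix (spMap (Int.castRingHom ℝ) γ * g) (basePoint n)).det‖ ^ 2 := by
  set γ' : Sp n ℝ := spMap (Int.castRingHom ℝ) γ
  have h_sub : (traceNorm g • lowerGram (γ' * g) - lowerGram γ').PosSemidef := by
    have h := (posSemidef_traceNorm_smul_mul_transpose_sub_one g).mul_mul_conjTranspose_same
      γ'.1.toRows₂
    have h_rows : (γ' * g).1.toRows₂ = γ'.1.toRows₂ * g.1 := rfl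
    convert h using 1
    rw [Matrix.mul_sub, Matrix.sub_mul, lowerGram, h_rows, lowerGram, transpose_mul,
      conjTranspose_eq_transpose_of_trivial, Matrix.mul_smul, Matrix.smul_mul, Matrix.mul_one]
    simp only [Matrix.mul_assoc]
  calc 1 ≤ (lowerGram γ').det := one_le_det_lowerGram_spMap_intCast γ
    _ ≤ (traceNorm g • lowerGram (γ' * g)).det :=
      det_le_det_of_posSemidef_sub (lowerGram_posDef γ') h_sub
    _ = _ := by rw [det_smul, Fintype.card_fin, norm_det_denomMatrix_sq]

end Automorphy

/-! ### Growth of irreducible rational representations of `GL_n(ℂ)` -/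

section RepresentationGrowth

variable {n : ℕ}

theorem exists_unitary_mul_upperTriangular (h : GeneralLinearGroup (Fin n) ℂ) :
    ∃ u b : GeneralLinearGroup (Fin n) ℂ, u.1 ∈ unitaryGroup (Fin n) ℂ ∧
      b.1.BlockTriangular id ∧ h = u * b := by
  let v (j : Fin n) : EuclideanSpace ℂ (Fin n) := WithLp.toLp 2 fun a => h.1 a j
  let q := InnerProductSpace.gramSchmidtOrthonormalBasis (𝕜 := ℂ) (by simp) v
  let K : Matrix (Fin n) (Fin n) ℂ := Matrix.of fun a i => q i a
  have h_apply (M : Matrix (Fin n) (Fin n) ℂ) (i j : Fin n) :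
      (Kᴴ * M) i j = inner ℂ (q i) (WithLp.toLp 2 fun a => M a j) := by
    simp [Matrix.mul_apply, PiLp.inner_apply, K, mul_comm]
  have hK : Kᴴ * K = 1 := by
    ext i j
    rw [h_apply, Matrix.one_apply]
    exact orthonormal_iff_ite.1 q.orthonormal i j
  let u : GeneralLinearGroup (Fin n) ℂ := ⟨K, Kᴴ, mul_eq_one_comm.1 hK, hK⟩
  refine ⟨u, u⁻¹ * h, mem_unitaryGroup_iff'.2 hK, fun i j hij => ?_,
    (mul_inv_cancel_left u h).symm⟩
  exact (h_apply h.1 i j).trans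
    (InnerProductSpace.gramSchmidtOrthonormalBasis_inv_triangular _ v hij)

theorem exists_upperTriangular_mul_unitary (B : GeneralLinearGroup (Fin n) ℂ) :
    ∃ c u : GeneralLinearGroup (Fin n) ℂ, c.1.BlockTriangular id ∧
      u.1 ∈ unitaryGroup (Fin n) ℂ ∧ B = c * u⁻¹ := by
  obtain ⟨u, b, hu, hb, h⟩ := exists_unitary_mul_upperTriangular B⁻¹
  refine ⟨b⁻¹, u, ?_, hu, by rw [← _root_.mul_inv_rev, ← h, inv_inv]⟩
  have := b.invertible
  rw [GeneralLinearGroup.coe_inv]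
  exact blockTriangular_inv_of_blockTriangular hb

theorem norm_mul_apply_le {l m o R : Type*} [Fintype m] [SeminormedRing R] {A : Matrix l m R}
    {B : Matrix m o R} {a b : ℝ} (hA : ∀ i j, ‖A i j‖ ≤ a) (hB : ∀ i j, ‖B i j‖ ≤ b)
    (i : l) (j : o) : ‖(A * B) i j‖ ≤ Fintype.card m * (a * b) := by
  rw [Matrix.mul_apply]
  calc ‖∑ k, A i k * B k j‖ ≤ ∑ _k : m, a * b :=
        norm_sum_le_of_le _ fun k _ => norm_mul_le_of_le (hA i k) (hB k j)
    _ = Fintype.card m * (a * b) := by rw [Finset.sum_const, Finset.card_univ, nsmul_eq_mul]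

theorem exists_bound_eval {σ 𝕜 : Type*} [NormedField 𝕜] [ProperSpace 𝕜] (P : MvPolynomial σ 𝕜)
    (R : ℝ) : ∃ C, ∀ x : σ → 𝕜, (∀ i, ‖x i‖ ≤ R) → ‖MvPolynomial.eval x P‖ ≤ C := by
  obtain ⟨C, hC⟩ := (isCompact_univ_pi fun _ : σ => isCompact_closedBall (0 : 𝕜) R)
    |>.exists_bound_of_continuousOn (MvPolynomial.continuous_eval P).continuousOn
  exact ⟨C, fun x hx => hC x fun i _ => mem_closedBall_zero_iff.2 (hx i)⟩

theorem representation_inv_apply_of_apply_eq_smul {k G V : Type*} [Field k] [Group G]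
    [AddCommGroup V] [Module k V] {ρ : Representation k G V} {g : G} {v : V} {a : k}
    (h : ρ g v = a • v) (ha : a ≠ 0) : ρ g⁻¹ v = a⁻¹ • v := by
  rw [eq_inv_smul_iff₀ ha, ← map_smul, ← h, Representation.inv_self_apply]

variable {V : Type*} [AddCommGroup V] [Module ℂ V]
  {ρ : Representation ℂ (GeneralLinearGroup (Fin n) ℂ) V}

theorem IsRational.exists_bound_unitary (hrat : IsRational ρ) (L : V →ₗ[ℂ] ℂ) (v : V) :
    ∃ C, ∀ u : GeneralLinearGroup (Fin n) ℂ, u.1 ∈ unitaryGroup (Fin n) ℂ →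
      ‖L (ρ u v)‖ ≤ C := by
  obtain ⟨P, k, hP⟩ := hrat L v
  obtain ⟨C, hC⟩ := exists_bound_eval P 1
  refine ⟨C, fun u hu => ?_⟩
  have h_det : ‖u.1.det‖ = 1 := CStarRing.norm_of_mem_unitary (det_of_mem_unitary hu)
  rw [hP, norm_mul, norm_inv, norm_pow, h_det, one_pow, inv_one, mul_one]
  exact hC _ fun ij => entry_norm_bound_of_unitary hu _ _

variable (ρ) in
/-- The vectors `v` for which `det(B) ^ l₀ * L (ρ(B)⁻¹ v)` is bounded on every bounded set of
invertible matrices `B`; they form a subrepresentation because `h⁻¹` maps bounded sets to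
bounded sets. -/
def boundedCoefficients (L : V →ₗ[ℂ] ℂ) (l₀ : ℤ) : Subrepresentation ρ where
  toSubmodule := {
    carrier := {v | ∀ R : ℝ, ∃ C, ∀ B : GeneralLinearGroup (Fin n) ℂ,
      (∀ i j, ‖B.1 i j‖ ≤ R) → ‖L (ρ B⁻¹ v)‖ * ‖B.1.det‖ ^ l₀ ≤ C}
    zero_mem' R := ⟨0, fun B _ => by simp⟩
    add_mem' {v w} hv hw R := by
      obtain ⟨C, hC⟩ := hv R
      obtain ⟨D, hD⟩ := hw R
      refine ⟨C + D, fun B hB => ?_⟩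
      rw [map_add, map_add]
      calc ‖L (ρ B⁻¹ v) + L (ρ B⁻¹ w)‖ * ‖B.1.det‖ ^ l₀
          ≤ (‖L (ρ B⁻¹ v)‖ + ‖L (ρ B⁻¹ w)‖) * ‖B.1.det‖ ^ l₀ := by
            gcongr
            exact norm_add_le _ _
        _ ≤ C + D := by
            rw [add_mul]
            exact add_le_add (hC B hB) (hD B hB)
    smul_mem' c v hv R := by
      obtain ⟨C, hC⟩ := hv R
      refine ⟨‖c‖ * C, fun B hB => ?_⟩
      rw [map_smul, map_smul, norm_smul, mul_assoc]
      exact mul_le_mul_of_nonneg_left (hC B hB) (norm_nonneg _)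
  }
  apply_mem_toSubmodule h v hv R := by
    open scoped Matrix.Norms.Elementwise in
    obtain ⟨C, hC⟩ := hv (Fintype.card (Fin n) * (‖(h⁻¹).1‖ * R))
    refine ⟨C * ‖h.1.det‖ ^ l₀, fun B hB => ?_⟩
    have h_det : B.1.det = (h⁻¹ * B).1.det * h.1.det := by
      rw [mul_comm, ← det_mul, ← Units.val_mul, mul_inv_cancel_left]
    have h_vec : ρ B⁻¹ (ρ h v) = ρ (h⁻¹ * B)⁻¹ v := by
      rw [_root_.mul_inv_rev, inv_inv, map_mul, Module.End.mul_apply]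
    rw [h_vec, h_det, norm_mul, mul_zpow, ← mul_assoc]
    gcongr
    exact hC _ (norm_mul_apply_le (fun _ _ => norm_entry_le_entrywise_sup_norm _) hB)

theorem highestWeightVector_mem_boundedCoefficients (hrat : IsRational ρ) {lam : Fin n → ℤ}
    {l₀ : ℤ} (hlam : ∀ i, lam i ≤ l₀) {v : V}
    (hv : ∀ b : GeneralLinearGroup (Fin n) ℂ, (∀ i j, j < i → b.1 i j = 0) →
      ρ b v = (∏ i, b.1 i i ^ lam i) • v) (L : V →ₗ[ℂ] ℂ) :
    v ∈ boundedCoefficients ρ L l₀ := by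
  intro R
  obtain ⟨C, hC⟩ := hrat.exists_bound_unitary L v
  refine ⟨(∏ i, (Fintype.card (Fin n) * (R * 1)) ^ (l₀ - lam i)) * C, fun B hB => ?_⟩
  obtain ⟨c, u, hc, hu, rfl⟩ := exists_upperTriangular_mul_unitary B
  have h_detc : c.1.det = ∏ i, c.1 i i := det_of_isUpperTriangular hc
  have h_diag (i : Fin n) : c.1 i i ≠ 0 :=
    Finset.prod_ne_zero_iff.1 (h_detc.symm.trans_ne c.det_ne_zero) i (Finset.mem_univ i)
  have h_detu : ‖u.1.det‖ = 1 := CStarRing.norm_of_mem_unitary (det_of_mem_unitary hu)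
  have h_diag_le (i : Fin n) : ‖c.1 i i‖ ≤ Fintype.card (Fin n) * (R * 1) := by
    have h_apply := norm_mul_apply_le hB (entry_norm_bound_of_unitary hu) i i
    rwa [← Units.val_mul, inv_mul_cancel_right] at h_apply
  have h_det : ‖(c * u⁻¹).1.det‖ = ∏ i, ‖c.1 i i‖ := by
    rw [← norm_prod, ← h_detc, ← mul_one ‖_‖, ← h_detu, ← norm_mul, ← det_mul, ← Units.val_mul,
      inv_mul_cancel_right]
  have h_vec : ρ (c * u⁻¹)⁻¹ v = (∏ i, c.1 i i ^ lam i)⁻¹ • ρ u v := by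
    have h_ne : ∏ i, c.1 i i ^ lam i ≠ 0 :=
      Finset.prod_ne_zero_iff.2 fun i _ => zpow_ne_zero _ (h_diag i)
    rw [_root_.mul_inv_rev, inv_inv, map_mul, Module.End.mul_apply,
      representation_inv_apply_of_apply_eq_smul (hv c fun i j hij => hc hij) h_ne, map_smul]
  calc ‖L (ρ (c * u⁻¹)⁻¹ v)‖ * ‖(c * u⁻¹).1.det‖ ^ l₀
      = (∏ i, ‖c.1 i i‖ ^ (l₀ - lam i)) * ‖L (ρ u v)‖ := by
        simp_rw [h_vec, h_det, map_smul, norm_smul, norm_inv, norm_prod, norm_zpow,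
          zpow_sub₀ (norm_ne_zero_iff.2 (h_diag _)), Finset.prod_div_distrib, Finset.prod_zpow]
        ring
    _ ≤ _ := by
        gcongr with i
        · exact Finset.prod_nonneg fun i _ =>
            zpow_nonneg ((norm_nonneg _).trans (h_diag_le i)) _
        · exact zpow_le_zpow_left₀ (sub_nonneg.2 (hlam i)) (norm_nonneg _) (h_diag_le i)
        · exact hC u hu

theorem exists_bound_inv_mul_det (hrat : IsRational ρ) (hirr : ρ.IsIrreducible)
    {lam : Fin n → ℤ} {l₀ : ℤ} (hlam : ∀ i, lam i ≤ l₀) (hweight : IsHighestWeight ρ lam)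
    (L : V →ₗ[ℂ] ℂ) (v : V) (R : ℝ) :
    ∃ C, ∀ B : GeneralLinearGroup (Fin n) ℂ, (∀ i j, ‖B.1 i j‖ ≤ R) →
      ‖L (ρ B⁻¹ v)‖ * ‖B.1.det‖ ^ l₀ ≤ C := by
  obtain ⟨v₀, hv₀, hv⟩ := hweight
  have h_top : boundedCoefficients ρ L l₀ = ⊤ := by
    refine (hirr.eq_bot_or_eq_top _).resolve_left fun h_bot => hv₀ ?_
    have h_mem := highestWeightVector_mem_boundedCoefficients hrat hlam hv L
    rw [h_bot] at h_mem
    exact (Submodule.mem_bot ℂ).1 h_mem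
  have h_mem : v ∈ boundedCoefficients ρ L l₀ := by
    rw [h_top]
    exact Submodule.mem_top
  exact h_mem R

end RepresentationGrowth

/-! ### Boundedness of Fourier expansions -/

section FourierExpansion

open SiegelUpperHalfSpace

variable {n p N : ℕ}

/-- The point `iY` of `ℍ_n`. -/
noncomputable def imagPoint (Y : Matrix (Fin n) (Fin n) ℝ) (hY : Y.PosDef) :
    SiegelUpperHalfSpace n :=
  ⟨Complex.I • Y.map Complex.ofReal, by
    have h_im : (Complex.I • Y.map Complex.ofReal).map Complex.im = Y := by
      ext i j
      simp
    have h_symm : Y.IsSymm := hY.isHermitian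
    exact ⟨(h_symm.map _).smul _, h_im.symm ▸ hY⟩⟩

theorem imPart_imagPoint (Y : Matrix (Fin n) (Fin n) ℝ) (hY : Y.PosDef) :
    imPart (imagPoint Y hY) = Y := by
  ext i j
  simp [imPart, imagPoint]

theorem norm_exp_trace (S : Matrix (Fin n) (Fin n) ℝ) (Z : SiegelUpperHalfSpace n) :
    ‖Complex.exp (2 * Real.pi * Complex.I *
      (S.map Complex.ofReal * (Z : Matrix (Fin n) (Fin n) ℂ)).trace)‖ =
      Real.exp (-(2 * Real.pi * (S * imPart Z).trace)) := by
  have h_im : (S.map Complex.ofReal * (Z : Matrix (Fin n) (Fin n) ℂ)).trace.im =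
      (S * imPart Z).trace := by
    simp [Matrix.trace, Matrix.mul_apply, imPart, Complex.im_sum]
  rw [Complex.norm_exp, ← h_im]
  congr 1
  simp [Complex.mul_re, Complex.mul_im]

theorem abs_monomial_le {A B : Matrix (Fin n) (Fin n) ℝ} (h : ∀ i j, |A i j| ≤ |B i j|)
    (b : UpperIndex n → ℕ) : |monomial A b| ≤ |monomial B b| := by
  simp only [monomial, Finset.abs_prod, abs_pow]
  exact Finset.prod_le_prod (fun _ _ => by positivity) fun ij _ =>
    pow_le_pow_left₀ (abs_nonneg _) (h _ _) _

theorem norm_fourierTerm_le (a : exponents n p → latticePSD n N → ℂ)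
    (x : exponents n p × latticePSD n N) {Z W : SiegelUpperHalfSpace n}
    (h : (imPart Z - imPart W).PosSemidef)
    (h_inv : ∀ i j, |(imPart Z)⁻¹ i j| ≤ |(imPart W)⁻¹ i j|) :
    ‖fourierTerm a x Z‖ ≤ ‖fourierTerm a x W‖ := by
  have h_trace := trace_mul_nonneg_of_posSemidef x.2.2.1 h
  rw [Matrix.mul_sub, Matrix.trace_sub, sub_nonneg] at h_trace
  simp only [fourierTerm, norm_mul, norm_exp_trace, Complex.norm_real, Real.norm_eq_abs]
  have h_mono := abs_monomial_le h_inv x.1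
  gcongr ?_ * Real.exp (-(2 * Real.pi * ?_)) * ?_

theorem posSemidef_vecMulVec_one : (vecMulVec (1 : Fin n → ℝ) 1).PosSemidef := by
  simpa using posSemidef_vecMulVec_self_star (1 : Fin n → ℝ)

theorem posSemidef_smul_one_add_vecMulVec_one_sub {A : Matrix (Fin n) (Fin n) ℝ}
    (hA : A.PosSemidef) {K : ℝ} (hK : A.trace ≤ K) :
    (K • (1 + vecMulVec 1 1) - A).PosSemidef := by
  have h_eq : K • (1 + vecMulVec 1 1) - A =
      (A.trace • 1 - A) + (K - A.trace) • 1 + K • vecMulVec 1 1 := by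
    rw [smul_add, sub_smul]
    abel
  rw [h_eq]
  exact ((posSemidef_trace_smul_one_sub hA).add (PosSemidef.one.smul (sub_nonneg.2 hK))).add
    (posSemidef_vecMulVec_one.smul (hA.trace_nonneg.trans hK))

theorem HasNiceFourierExpansion.exists_bound {f : SiegelUpperHalfSpace n → ℂ}
    (hf : HasNiceFourierExpansion p f) (K : ℝ) :
    ∃ C, ∀ Z : SiegelUpperHalfSpace n, (imPart Z)⁻¹.trace ≤ K → ‖f Z‖ ≤ C := by
  obtain ⟨N, -, a, h_summable, h_unif⟩ := hf
  -- Both `Y⁻¹ ≤ H` and `|Y⁻¹| ≤ H` entrywise, so every term at `Z` is dominated by the one at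
  -- `iH⁻¹`.
  let H : Matrix (Fin n) (Fin n) ℝ := max K 1 • (1 + vecMulVec 1 1)
  have hH : H.PosDef := (PosDef.one.add_posSemidef posSemidef_vecMulVec_one).smul (by positivity)
  let W := imagPoint H⁻¹ hH.inv
  have hW : (imPart W)⁻¹ = H := by
    rw [imPart_imagPoint, nonsing_inv_nonsing_inv _ hH.det_pos.ne'.isUnit]
  refine ⟨∑' x, ‖fourierTerm a x W‖, fun Z hZ => ?_⟩
  have hY : (imPart Z).PosDef := Z.2.2
  have h_trace : (imPart Z)⁻¹.trace ≤ max K 1 := hZ.trans (le_max_left _ _)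
  have h_sub : (imPart Z - imPart W).PosSemidef := by
    have h := posSemidef_inv_sub_inv hY.inv hH
      (posSemidef_smul_one_add_vecMulVec_one_sub hY.inv.posSemidef h_trace)
    rwa [nonsing_inv_nonsing_inv _ hY.det_pos.ne'.isUnit, ← imPart_imagPoint H⁻¹ hH.inv] at h
  have h_inv (i j : Fin n) : |(imPart Z)⁻¹ i j| ≤ |(imPart W)⁻¹ i j| := by
    have h_entry : max K 1 ≤ H i j := by
      by_cases hij : i = j <;> simp [H, hij]
    rw [hW]
    exact (abs_apply_le_trace_of_posSemidef hY.inv.posSemidef i j).trans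
      (h_trace.trans (h_entry.trans (le_abs_self _)))
  rw [← ((h_unif {Z} isCompact_singleton).hasSum (Set.mem_singleton Z)).tsum_eq]
  exact (norm_tsum_le_tsum_norm (h_summable Z)).trans ((h_summable Z).tsum_le_tsum
    (fun x => norm_fourierTerm_le a x h_sub h_inv) (h_summable W))

end FourierExpansion

/-! ### Translates of a modular form -/

section Translates

open SiegelUpperHalfSpace

variable {n : ℕ}

theorem map_ofReal_mul_fromRows (g : Sp n ℝ) (Z : SiegelUpperHalfSpace n) :
    g.1.map Complex.ofReal * fromRows Z.1 (1 : Matrix (Fin n) (Fin n) ℂ) =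
      fromRows (numMatrix g Z) (denomMatrix g Z) := by
  rw [← fromBlocks_toBlocks g.1, fromBlocks_map, fromBlocks_mul_fromRows, Matrix.mul_one,
    Matrix.mul_one]
  rfl

theorem fromRows_act_one_mul_denomMatrix (g : Sp n ℝ) (Z : SiegelUpperHalfSpace n) :
    fromRows (act g Z).1 (1 : Matrix (Fin n) (Fin n) ℂ) * denomMatrix g Z =
      g.1.map Complex.ofReal * fromRows Z.1 (1 : Matrix (Fin n) (Fin n) ℂ) := by
  rw [fromRows_mul, act_mul_denomMatrix, Matrix.one_mul, map_ofReal_mul_fromRows]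

theorem numMatrix_mul_and_denomMatrix_mul (g h : Sp n ℝ) (Z : SiegelUpperHalfSpace n) :
    numMatrix (g * h) Z = numMatrix g (act h Z) * denomMatrix h Z ∧
      denomMatrix (g * h) Z = denomMatrix g (act h Z) * denomMatrix h Z := by
  have h_mul : (g * h).1.map Complex.ofReal = g.1.map Complex.ofReal * h.1.map Complex.ofReal :=
    Matrix.map_mul (f := Complex.ofRealHom)
  have h_rows : fromRows (numMatrix (g * h) Z) (denomMatrix (g * h) Z) =
      fromRows (numMatrix g (act h Z) * denomMatrix h Z)
        (denomMatrix g (act h Z) * denomMatrix h Z) := by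
    rw [← map_ofReal_mul_fromRows, h_mul, Matrix.mul_assoc, ← fromRows_act_one_mul_denomMatrix,
      ← Matrix.mul_assoc, map_ofReal_mul_fromRows, fromRows_mul]
  exact fromRows_ext_iff _ _ _ _ |>.1 h_rows

theorem act_mul (g h : Sp n ℝ) (Z : SiegelUpperHalfSpace n) :
    act (g * h) Z = act g (act h Z) := by
  apply Subtype.ext
  change numMatrix (g * h) Z * (denomMatrix (g * h) Z)⁻¹ =
    numMatrix g (act h Z) * (denomMatrix g (act h Z))⁻¹
  obtain ⟨h_num, h_denom⟩ := numMatrix_mul_and_denomMatrix_mul g h Z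
  rw [h_num, h_denom, Matrix.mul_inv_rev, ← Matrix.mul_assoc,
    Matrix.mul_nonsing_inv_cancel_right _ _ (isUnit_det_denom h Z)]

theorem autFactor_mul (g h : Sp n ℝ) (Z : SiegelUpperHalfSpace n) :
    autFactor (g * h) Z = autFactor g (act h Z) * autFactor h Z :=
  Units.ext (numMatrix_mul_and_denomMatrix_mul g h Z).2

theorem spRatToReal_spMap_intCast (γ : Sp n ℤ) :
    spRatToReal (spMap (Int.castRingHom ℚ) γ) = spMap (Int.castRingHom ℝ) γ := by
  ext i j
  exact Rat.cast_intCast _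

theorem finite_image_of_relIndex_ne_zero {G α : Type*} [Group G] {Γ H : Subgroup G}
    (h : Γ.relIndex H ≠ 0) {f : G → α} (hf : ∀ γ ∈ Γ, ∀ q, f (γ * q) = f q) :
    (f '' H).Finite := by
  have : (Γ.subgroupOf H).FiniteIndex := ⟨h⟩
  let f' : H ⧸ Γ.subgroupOf H → α := Quotient.lift (fun q : H => f (q : G)⁻¹) fun a b hab => by
    have h_mem : (a : G)⁻¹ * b ∈ Γ := Subgroup.mem_subgroupOf.1 (QuotientGroup.leftRel_apply.1 hab)
    rw [← hf _ h_mem (b : G)⁻¹, mul_inv_cancel_right]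
  refine (Set.finite_range f').subset ?_
  rintro _ ⟨q, hq, rfl⟩
  exact ⟨QuotientGroup.mk ⟨q⁻¹, H.inv_mem hq⟩, congrArg f (inv_inv q)⟩

variable {V : Type*} [AddCommGroup V] [Module ℂ V]
  {ρ : Representation ℂ (GeneralLinearGroup (Fin n) ℂ) V}

theorem slash_mul (F : SiegelUpperHalfSpace n → V) (g h : Sp n ℝ) :
    slash ρ F (g * h) = slash ρ (slash ρ F g) h := by
  ext Z
  rw [slash, slash, slash, autFactor_mul, act_mul, _root_.mul_inv_rev, map_mul,
    Module.End.mul_apply]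

theorem vecLift_mul (F : SiegelUpperHalfSpace n → V) (g h : Sp n ℝ) :
    vecLift ρ F (g * h) = vecLift ρ (slash ρ F g) h :=
  congrFun (slash_mul F g h) (basePoint n)

theorem finite_slash_image {Γ H : Subgroup (Sp n ℚ)} (hΓ : Γ.relIndex H ≠ 0)
    {F : SiegelUpperHalfSpace n → V} (hF : ∀ γ ∈ Γ, slash ρ F (spRatToReal γ) = F) :
    ((fun q => slash ρ F (spRatToReal q)) '' H).Finite :=
  finite_image_of_relIndex_ne_zero hΓ fun γ hγ q => by
    rw [map_mul, slash_mul, hF γ hγ]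

end Translates

/-! ### Growth of the lift -/

section LiftGrowth

open SiegelUpperHalfSpace

variable {n : ℕ}

theorem norm_denomMatrix_apply_le {g : Sp n ℝ} {K : ℝ}
    (hg : (imPart (act g (basePoint n)))⁻¹.trace ≤ K) (i j : Fin n) :
    ‖denomMatrix g (basePoint n) i j‖ ≤ √K := by
  rw [inv_imPart_act_basePoint, trace_lowerGram] at hg
  refine Real.le_sqrt_of_sq_le (le_trans ?_ hg)
  calc ‖denomMatrix g (basePoint n) i j‖ ^ 2
      ≤ ∑ j, ‖denomMatrix g (basePoint n) i j‖ ^ 2 :=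
        Finset.single_le_sum (f := fun j => ‖denomMatrix g (basePoint n) i j‖ ^ 2)
          (fun _ _ => sq_nonneg _) (Finset.mem_univ j)
    _ ≤ ∑ i, ∑ j, ‖denomMatrix g (basePoint n) i j‖ ^ 2 :=
        Finset.single_le_sum (f := fun i => ∑ j, ‖denomMatrix g (basePoint n) i j‖ ^ 2)
          (fun _ _ => Finset.sum_nonneg fun _ _ => sq_nonneg _) (Finset.mem_univ i)

section Lift

variable {V : Type*} [AddCommGroup V] [Module ℂ V] [FiniteDimensional ℂ V]
  {ρ : Representation ℂ (GeneralLinearGroup (Fin n) ℂ) V} {lam : Fin n → ℤ} {l₀ : ℤ} {p : ℕ}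

theorem exists_bound_vecLift_of_trace_le (hrat : IsRational ρ) (hirr : ρ.IsIrreducible)
    (hlam : ∀ i, lam i ≤ l₀) (hweight : IsHighestWeight ρ lam) {G : SiegelUpperHalfSpace n → V}
    (hG : ∀ l : V →ₗ[ℂ] ℂ, HasNiceFourierExpansion p fun Z => l (G Z)) (L : V →ₗ[ℂ] ℂ) (K : ℝ) :
    ∃ C, ∀ g : Sp n ℝ, (imPart (act g (basePoint n)))⁻¹.trace ≤ K →
      ‖L (vecLift ρ G g)‖ * ‖(denomMatrix g (basePoint n)).det‖ ^ l₀ ≤ C := by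
  let b := Module.finBasis ℂ V
  choose M hM using fun k => (hG (b.coord k)).exists_bound K
  choose D hD using fun k => exists_bound_inv_mul_det hrat hirr hlam hweight L (b k) (√K)
  refine ⟨∑ k, M k * D k, fun g hg => ?_⟩
  set B := autFactor g (basePoint n)
  set Z := act g (basePoint n)
  have h_expand : L (vecLift ρ G g) = ∑ k, b.coord k (G Z) * L (ρ B⁻¹ (b k)) := by
    calc L (vecLift ρ G g) = L (ρ B⁻¹ (∑ k, b.coord k (G Z) • b k)) :=
          congrArg (fun v => L (ρ B⁻¹ v)) (b.sum_repr (G Z)).symm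
      _ = _ := by simp only [map_sum, map_smul, smul_eq_mul]
  calc ‖L (vecLift ρ G g)‖ * ‖B.1.det‖ ^ l₀
      ≤ (∑ k, ‖b.coord k (G Z)‖ * ‖L (ρ B⁻¹ (b k))‖) * ‖B.1.det‖ ^ l₀ := by
        rw [h_expand]
        gcongr
        exact norm_sum_le_of_le _ fun k _ => (norm_mul _ _).le
    _ = ∑ k, ‖b.coord k (G Z)‖ * (‖L (ρ B⁻¹ (b k))‖ * ‖B.1.det‖ ^ l₀) := by
        simp only [Finset.sum_mul, mul_assoc]
    _ ≤ ∑ k, M k * D k := by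
        gcongr with k
        · exact (norm_nonneg _).trans (hM k Z hg)
        · exact hM k Z hg
        · exact hD k B (norm_denomMatrix_apply_le hg)

theorem exists_bound_vecLift (hrat : IsRational ρ) (hirr : ρ.IsIrreducible)
    (hlam : ∀ i, lam i ≤ l₀) (hweight : IsHighestWeight ρ lam) {Γ : Subgroup (Sp n ℚ)}
    (hΓ : Γ.relIndex (spInt n) ≠ 0) {F : SiegelUpperHalfSpace n → V}
    (hF : ∀ γ ∈ Γ, slash ρ F (spRatToReal γ) = F)
    (h_nice : ∀ q ∈ spInt n, ∀ l : V →ₗ[ℂ] ℂ,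
      HasNiceFourierExpansion p fun Z => l (slash ρ F (spRatToReal q) Z)) (L : V →ₗ[ℂ] ℂ) :
    ∃ C, ∀ g : Sp n ℝ, ∃ γ : Sp n ℤ, ‖L (vecLift ρ F g)‖ *
      ‖(denomMatrix (spMap (Int.castRingHom ℝ) γ * g) (basePoint n)).det‖ ^ l₀ ≤ C := by
  have h_fin := finite_slash_image hΓ hF
  have h_bound (G) (hG : G ∈ (fun q => slash ρ F (spRatToReal q)) '' spInt n) :=
    exists_bound_vecLift_of_trace_le hrat hirr hlam hweight (G := G) (p := p)
      (by obtain ⟨q, hq, rfl⟩ := hG; exact h_nice q hq) L (n * reductionConst n)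
  choose! C hC using h_bound
  obtain ⟨M, hM⟩ := (h_fin.image C).bddAbove
  refine ⟨M, fun g => ?_⟩
  obtain ⟨γ, hγ⟩ := exists_trace_inv_imPart_act_le g
  let q := (spMap (Int.castRingHom ℚ) γ)⁻¹
  have hq : slash ρ F (spRatToReal q) ∈ (fun q => slash ρ F (spRatToReal q)) '' spInt n :=
    ⟨q, (spInt n).inv_mem ⟨γ, rfl⟩, rfl⟩
  have h_factor : g = spRatToReal q * (spMap (Int.castRingHom ℝ) γ * g) := by
    rw [map_inv, spRatToReal_spMap_intCast, inv_mul_cancel_left]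
  have h_lift : vecLift ρ F g =
      vecLift ρ (slash ρ F (spRatToReal q)) (spMap (Int.castRingHom ℝ) γ * g) := by
    rw [← vecLift_mul, ← h_factor]
  refine ⟨γ, ?_⟩
  rw [h_lift]
  exact (hC _ hq _ hγ).trans (hM ⟨_, hq, rfl⟩)

end Lift

theorem one_le_rpow_mul_zpow {τ d r : ℝ} {l : ℤ} (hτ : 1 ≤ τ) (hd : 0 ≤ d)
    (h : 1 ≤ τ ^ n * d ^ 2) (hl : 0 ≤ l) (hr : n * l / 2 ≤ r) : 1 ≤ τ ^ r * d ^ l := by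
  lift l to ℕ using hl
  have hτ₀ : 0 ≤ τ := zero_le_one.trans hτ
  have h_sq : (τ ^ (n * l / 2 : ℝ) * d ^ l) ^ 2 = (τ ^ n * d ^ 2) ^ l := by
    have h_rpow : (τ ^ (n * l / 2 : ℝ)) ^ 2 = (τ ^ n) ^ l := by
      rw [← Real.rpow_mul_natCast hτ₀, ← pow_mul, ← Real.rpow_natCast]
      push_cast
      ring_nf
    rw [mul_pow, mul_pow, h_rpow, pow_right_comm d]
  calc 1 ≤ τ ^ (n * l / 2 : ℝ) * d ^ l := by
        rw [← one_le_sq_iff₀ (by positivity), h_sq]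
        exact one_le_pow₀ h
    _ ≤ τ ^ r * d ^ (l : ℤ) := by
        rw [zpow_natCast]
        gcongr
        simpa using hr

theorem hasModerateGrowth_of_forall_le_rpow {Φ : Sp n ℝ → ℂ} {C s : ℝ}
    (h : ∀ r, s ≤ r → ∀ g, ‖Φ g‖ ≤ C * traceNorm g ^ r) : HasModerateGrowth Φ := by
  refine ⟨C, ⌈s⌉₊ + 1, Nat.succ_pos _, fun g => ?_⟩
  rw [← Real.rpow_natCast]
  refine h _ ((Nat.le_ceil s).trans ?_) g
  exact_mod_cast Nat.le_succ _

end LiftGrowth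

end SiegelForms

open SiegelForms SiegelUpperHalfSpace in
theorem theorem4p2_general {n : ℕ} [NeZero n] {V : Type*} [AddCommGroup V] [Module ℂ V]
    [FiniteDimensional ℂ V]
    (ρ : Representation ℂ (GeneralLinearGroup (Fin n) ℂ) V)
    (hrat : IsRational ρ) (hirr : ρ.IsIrreducible)
    (lam : Fin n → ℤ) {l₀ : ℤ} (hl₀ : 0 ≤ l₀) (hlam : ∀ i, lam i ≤ l₀)
    (hweight : IsHighestWeight ρ lam)
    {Γ : Subgroup (Sp n ℚ)} (hΓ : Γ.relIndex (spInt n) ≠ 0) {p : ℕ}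
    {F : SiegelUpperHalfSpace n → V}
    (hF : ∀ γ ∈ Γ, slash ρ F (spRatToReal γ) = F)
    (h_nice : ∀ q ∈ spInt n, ∀ l : V →ₗ[ℂ] ℂ, HasNiceFourierExpansion p
      fun Z => l (slash ρ F (spRatToReal q) Z))
    (L : V →ₗ[ℂ] ℂ) :
    ∃ C : ℝ, ∀ r : ℝ, (n : ℝ) * (l₀ : ℝ) / 2 ≤ r → ∀ g : Sp n ℝ,
      ‖L (vecLift ρ F g)‖ ≤ C * traceNorm g ^ r := by
  obtain ⟨C, hC⟩ := exists_bound_vecLift hrat hirr hlam hweight hΓ hF h_nice L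
  refine ⟨C, fun r hr g => ?_⟩
  obtain ⟨γ, hγ⟩ := hC g
  set Φ := ‖L (vecLift ρ F g)‖
  set τ := traceNorm g
  set d := ‖(denomMatrix (spMap (Int.castRingHom ℝ) γ * g) (basePoint n)).det‖
  have hτ : 1 ≤ τ := one_le_traceNorm g
  have h_one_le : 1 ≤ τ ^ r * d ^ l₀ :=
    one_le_rpow_mul_zpow hτ (norm_nonneg _)
      (one_le_traceNorm_pow_mul_norm_det_sq γ g) hl₀ hr
  calc Φ ≤ Φ * (τ ^ r * d ^ l₀) := le_mul_of_one_le_right (norm_nonneg _) h_one_le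
    _ = Φ * d ^ l₀ * τ ^ r := by ring
    _ ≤ C * τ ^ r := by gcongr

theorem theorem4p2 {n : ℕ} [NeZero n] {V : Type*} [AddCommGroup V] [Module ℂ V]
    [FiniteDimensional ℂ V]
    (ρ : Representation ℂ (Matrix.GeneralLinearGroup (Fin n) ℂ) V)
    (hrat : SiegelForms.IsRational ρ) (hirr : ρ.IsIrreducible)
    (lam : Fin n → ℤ) (hlam : Antitone lam) (hlam0 : ∀ i, 0 ≤ lam i)
    (hweight : SiegelForms.IsHighestWeight ρ lam)
    (F : SiegelUpperHalfSpace n → V) (hF : SiegelForms.IsNearlyHolomorphicForm ρ F)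
    (L : V →ₗ[ℂ] ℂ) :
    SiegelForms.HasModerateGrowth (fun g => L (SiegelForms.vecLift ρ F g)) ∧
    ∃ C : ℝ, ∀ r : ℝ, (n : ℝ) * (lam 0 : ℝ) / 2 ≤ r → ∀ g : SiegelForms.Sp n ℝ,
      ‖L (SiegelForms.vecLift ρ F g)‖ ≤ C * SiegelForms.traceNorm g ^ r := by
  obtain ⟨Γ, p, hΓ, hF⟩ := hF
  obtain ⟨C, hC⟩ := theorem4p2_general ρ hrat hirr lam (hlam0 0) (fun i => hlam (Fin.zero_le i))
    hweight hΓ.1.1 hF.transformation (fun q _ => hF.niceFourierExpansion q) L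
  exact ⟨SiegelForms.hasModerateGrowth_of_forall_le_rpow hC, C, hC⟩
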